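/- **Language.** Terms are $t ::= c \mid x \mid (t\cdot t) \mid\, !t$ (constants $c$, variables $x$). $\mathsf{PPJ}$-formulas are $A ::= p \mid \lnot A \mid A\land A \mid t:A \mid P_{\ge s}A$ with $s\in\mathbb Q\cap[0,1]$. Abbreviations: $A\to B:=\lnot(A\land\lnot B)$, $A\lor B:=\lnot(\lnot A\land\lnot B)$, $P_{<s}A:=\lnot P_{\ge s}A$, $P_{\le s}A:=P_{\ge 1-s}\lnot A$. The axioms are the instances of a finite list $\Gamma$ of propositional schemata (e.g. any axiomatization of classical propositional logic) and of: $P_{\ge0}A$; $P_{\le r}A\to P_{<s}A$ ($r<s$); $P_{<s}A\to P_{\le s}A$; $P_{\ge r}A\land P_{\ge s}B\land P_{\ge1}\lnot(A\land B)\to P_{\ge\min(1,r+s)}(A\lor B)$; $P_{\le r}A\land P_{<s}B\to P_{<r+s}(A\lor B)$ ($r+s\le1$); $u:(A\to B)\to(v:A\to u\cdot v:B)$. **Models.** An $M$-model is a pair $\langle v,\mathcal E\rangle$ of a truth assignment $v$ to the atomic propositions and a function $\mathcal E$ from terms to sets of formulas such that $A\to B\in\mathcal E(s)$ and $A\in\mathcal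 E(t)$ imply $B\in\mathcal E(s\cdot t)$, and $!^{n-1}c:\cdots:{!c}:c:A\in\mathcal E(!^nc)$ for every constant $c$, axiom $A$ and $n\in\mathbb N$. A model consists of a non-empty set $U$ of worlds and, for each $w\in U$, an $M$-model $\langle v_w,\mathcal E_w\rangle$ and a finitely additive probability space $\langle W_w,H_w,\mu_w\rangle$ with $\emptyset\ne W_w\subseteq U$ and $H_w$ an algebra of subsets of $W_w$. Satisfaction at $w$: $p$ iff $v_w(p)$ is true; $\lnot,\land$ classically; $t:A$ iff $A\in\mathcal E_w(t)$; $P_{\ge s}A$ iff $\mu_w([A]_w)\ge s$, where $[A]_w=\{u\in W_w: u\models A\}$. The model is measurable if $[A]_w\in H_w$ for all $w$ and $A$. **Tableau procedure for $A$.** Branches are finite sequences of signed formulas $T\,B$, $F\,B$, all belonging to one world; the root is $T\,A$. A branch is closed if it contains $T\,B$ and $F\,B$ for some $B$, and open otherwise. Rules are applied, in any order allowed below, until every branch is closed or complete (no rule applicable). * Propositional rules, applicable when they add something new: from $T\,\lnot B$ add $F\,B$; from $F\,\lnot B$ add $T\,B$; from $T\,B\land C$ add $T\,B$ and $T\,C$;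 from $F\,B\land C$ split into $F\,B$ and $F\,C$ (applicable if neither is on the branch). Formulas $t:B$ are treated as atomic. * Probabilistic rule, applicable to an open branch $b_w$ of a world $w$ to which no propositional rule applies and on which some formula with outermost $P_{\ge s}$ occurs: let $B_1,\dots,B_m$ be the distinct formulas $C$ such that $T\,P_{\ge s}C$ or $F\,P_{\ge s}C$ is on $b_w$ for some $s$. For each of the $2^m$ choices of signs $\varepsilon$ create a new world $w.\varepsilon$ whose branches start with the single node $T\,(\pm B_1\land\cdots\land\pm B_m)$, where $\pm B_j$ is $B_j$ or $\lnot B_j$ according to $\varepsilon_j$. Then worlds are marked from the leaves to the root. A world is marked satisfiable iff some branch of it is open, passes the justification check, and is complete or ends in an application of the probabilistic rule that is marked satisfiable. An application of the probabilistic rule to $b_w$ is marked satisfiable iff the following system has a real solution: $\sum_\varepsilon x_\varepsilon=1$; $x_\varepsilon\ge0$; $x_\varepsilon=0$ if $w.\varepsilon$ is not marked satisfiable; $\sum_{\varepsilon_j=+}x_\varepsilon\ge s$ for each $T\,P_{\ge s}B_j$ on $b_w$; $\sum_{\varepsilon_j=+}x_\varepsilon<s$ for each $F\,P_{\ge s}B_j$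 on $b_w$. *Justification check.* To each term $t$ assign finitely many candidates, each a schematic formula together with equations between schematic formulas and a linear system over rational variables (the indices of probability operators in schemata are linear expressions): every $B$ with $T\,t:B$ on the branch; if $t={!^n}c$, all $!^{n-1}c:\cdots:c:X$ with $X$ an axiom schema, carrying as linear system its side conditions and the condition that rational variables lie in $[0,1]$ (the schema with $\min(1,r+s)$ is split into the cases $r+s\le1$ and $r+s\ge1$); if $t=u\cdot v$, for each candidate $X$ of $u$ and $Y$ of $v$, with variables renamed apart, a fresh formula variable $Z$ subject to $X\doteq(Y\to Z)$ and to the equations and linear systems of $X$ and $Y$. The branch passes iff for every $F\,t:B$ on it and every candidate $X$ of $t$, the following fails: the first-order unification algorithm succeeds on $X\doteq B$ and the equations of $X$, and the linear equations it produces by comparing probability indices are solvable in $\mathbb Q$ together with the linear system of $X$. The procedure returns "satisfiable" iff the world of the root is marked satisfiable. **Theorem.** Let $A$ be a $\mathsf{PPJ}$-formula. Every run of the procedure on $A$ terminates (there is no infinite sequence of branches, starting with the root, in which each results from its predecessor by a rule application), there is a fully developed tableau for $A$, and for every fully developed tableau for $A$ the procedure returns "satisfiable" if and only if $A$ is satisfiable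 at some world of some measurable model. -/

import Mathlib

universe u

namespace PPJ

/-! ## Language -/

/-- Justification terms: constants, variables, application and the operator `!`. -/
inductive Tm where
  | const (c : ℕ)
  | var (x : ℕ)
  | app (s t : Tm)
  | bang (t : Tm)
  deriving DecidableEq

/-- The rational numbers in `[0,1]`. -/
abbrev Rat01 : Type := Set.Icc (0 : ℚ) 1

/-- `1 - s` for `s` in `[0,1]`. -/
def Rat01.compl (s : Rat01) : Rat01 :=
  ⟨1 - s.1, sub_nonneg.mpr s.2.2, sub_le_self 1 s.2.1⟩

/-- `min (1, r + s)`. -/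
def Rat01.truncAdd (r s : Rat01) : Rat01 :=
  ⟨min 1 (r.1 + s.1), le_min zero_le_one (add_nonneg r.2.1 s.2.1), min_le_left _ _⟩

/-- `r + s` when this is at most `1`. -/
def Rat01.addOf (r s : Rat01) (h : r.1 + s.1 ≤ 1) : Rat01 :=
  ⟨r.1 + s.1, add_nonneg r.2.1 s.2.1, h⟩

/-- Formulas of probabilistic justification logic. -/
inductive Formula where
  | atom (p : ℕ)
  | neg (A : Formula)
  | conj (A B : Formula)
  /-- `t : A` -/
  | just (t : Tm) (A : Formula)
  /-- `P_{≥ s} A` -/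
  | prob (s : Rat01) (A : Formula)

namespace Formula

def imp (A B : Formula) : Formula := neg (conj A (neg B))

def disj (A B : Formula) : Formula := neg (conj (neg A) (neg B))

/-- `P_{< s} A`, an abbreviation of `¬ P_{≥ s} A`. -/
def probLt (s : Rat01) (A : Formula) : Formula := neg (prob s A)

/-- `P_{≤ s} A`, an abbreviation of `P_{≥ 1 - s} ¬ A`. -/
def probLe (s : Rat01) (A : Formula) : Formula := prob s.compl (neg A)

end Formula

/-! ## Axioms -/

/-- Schemata of propositional logic: propositional formulas over schematic letters. -/
inductive PropSchema where
  | letter (n : ℕ)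
  | neg (X : PropSchema)
  | conj (X Y : PropSchema)

/-- The instance of a propositional schema under an assignment of formulas to its letters. -/
def PropSchema.inst (σ : ℕ → Formula) : PropSchema → Formula
  | letter n => σ n
  | neg X => .neg (X.inst σ)
  | conj X Y => .conj (X.inst σ) (Y.inst σ)

/-- The axiom instances of `PPJ` whose axiom schemata for classical propositional logic are
those in the finite list `Γ`. -/
inductive IsAxiom (Γ : List PropSchema) : Formula → Prop
  | prop (X : PropSchema) (hX : X ∈ Γ) (σ : ℕ → Formula) : IsAxiom Γ (X.inst σ)
  | pi (A : Formula) : IsAxiom Γ (.prob 0 A)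
  | we (r s : Rat01) (h : r < s) (A : Formula) :
      IsAxiom Γ (.imp (.probLe r A) (.probLt s A))
  | le (s : Rat01) (A : Formula) :
      IsAxiom Γ (.imp (.probLt s A) (.probLe s A))
  | dis (r s : Rat01) (A B : Formula) :
      IsAxiom Γ (.imp
        (.conj (.conj (.prob r A) (.prob s B)) (.prob 1 (.neg (.conj A B))))
        (.prob (r.truncAdd s) (.disj A B)))
  | un (r s : Rat01) (h : r.1 + s.1 ≤ 1) (A B : Formula) :
      IsAxiom Γ (.imp
        (.conj (.probLe r A) (.probLt s B))
        (.probLt (r.addOf s h) (.disj A B)))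
  | j (s t : Tm) (A B : Formula) :
      IsAxiom Γ (.imp (.just s (.imp A B)) (.imp (.just t A) (.just (.app s t) B)))

/-! ## Models -/

/-- `!ⁿ t` -/
def Tm.bangs (t : Tm) : ℕ → Tm
  | 0 => t
  | n + 1 => .bang (t.bangs n)

/-- The formula `!ⁿ⁻¹ c : !ⁿ⁻² c : ⋯ : ! c : c : A` (which is `A` when `n = 0`). -/
def Formula.bangTower (c : ℕ) (A : Formula) : ℕ → Formula
  | 0 => A
  | n + 1 => .just ((Tm.const c).bangs n) (bangTower c A n)

/-- `M`-models: a truth assignment together with an evidence function. -/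
structure MModel (Γ : List PropSchema) where
  val : ℕ → Bool
  evid : Tm → Set Formula
  evid_app : ∀ (s t : Tm) (A B : Formula),
    Formula.imp A B ∈ evid s → A ∈ evid t → B ∈ evid (.app s t)
  evid_const : ∀ (c n : ℕ) (A : Formula), IsAxiom Γ A →
    Formula.bangTower c A n ∈ evid ((Tm.const c).bangs n)

/-- Finitely additive probability spaces whose set of states is a non-empty set `W` of
elements of `U`. -/
structure ProbSpace (U : Type u) where
  W : Set U
  nonempty : W.Nonempty
  H : Set (Set U)
  subset_of_mem : ∀ X ∈ H, X ⊆ W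
  whole_mem : W ∈ H
  union_mem : ∀ X ∈ H, ∀ Y ∈ H, X ∪ Y ∈ H
  diff_mem : ∀ X ∈ H, W \ X ∈ H
  μ : H → Set.Icc (0 : ℝ) 1
  μ_whole : (μ ⟨W, whole_mem⟩ : ℝ) = 1
  μ_union : ∀ X Y : H, Disjoint X.1 Y.1 →
    (μ ⟨X.1 ∪ Y.1, union_mem X.1 X.2 Y.1 Y.2⟩ : ℝ) = (μ X : ℝ) + (μ Y : ℝ)

/-- Models with set of worlds `U`: every world carries a probability space of worlds and an
`M`-model. -/
structure Model (Γ : List PropSchema) (U : Type u) where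
  space : U → ProbSpace U
  mmodel : U → MModel Γ

/-- Satisfaction of a formula at a world. In a measurable model the set in the clause for
`P_{≥ s} A` always belongs to `H_w`, so that there the clause says `μ_w [A]_{M,w} ≥ s`. -/
def Model.Sat {Γ : List PropSchema} {U : Type u} (M : Model Γ U) : Formula → U → Prop
  | .atom p, w => (M.mmodel w).val p = true
  | .neg A, w => ¬ M.Sat A w
  | .conj A B, w => M.Sat A w ∧ M.Sat B w
  | .just t A, w => A ∈ (M.mmodel w).evid t
  | .prob s A, w =>
      ∃ h : {v | v ∈ (M.space w).W ∧ M.Sat A v} ∈ (M.space w).H,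
        ((s.1 : ℚ) : ℝ) ≤ ((M.space w).μ ⟨_, h⟩ : ℝ)

/-- The set `[A]_{M,w}`. -/
def Model.truthSet {Γ : List PropSchema} {U : Type u} (M : Model Γ U) (A : Formula) (w : U) :
    Set U :=
  {v | v ∈ (M.space w).W ∧ M.Sat A v}

def Model.Measurable {Γ : List PropSchema} {U : Type u} (M : Model Γ U) : Prop :=
  ∀ (w : U) (A : Formula), M.truthSet A w ∈ (M.space w).H

/-- `A` is satisfiable in a measurable model. -/
def MeasSatisfiable (Γ : List PropSchema) (A : Formula) : Prop :=
  ∃ (U : Type u) (M : Model Γ U), M.Measurable ∧ ∃ w : U, M.Sat A w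

/-! ## Schemata with linear side conditions, and their unification -/

/-- Linear expressions with rational constants over variables for rational numbers. -/
inductive Lin where
  | const (q : ℚ)
  | var (n : ℕ)
  | add (e f : Lin)
  | sub (e f : Lin)

namespace Lin

def eval (ρ : ℕ → ℚ) : Lin → ℚ
  | const q => q
  | var n => ρ n
  | add e f => e.eval ρ + f.eval ρ
  | sub e f => e.eval ρ - f.eval ρ

def rename (k : ℕ → ℕ) : Lin → Lin
  | const q => const q
  | var n => var (k n)
  | add e f => add (e.rename k) (f.rename k)
  | sub e f => sub (e.rename k) (f.rename k)

end Lin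

/-- Linear equations, weak inequalities and strict inequalities. -/
inductive LinCon where
  | eq (e f : Lin)
  | le (e f : Lin)
  | lt (e f : Lin)

namespace LinCon

def Holds (ρ : ℕ → ℚ) : LinCon → Prop
  | eq e f => e.eval ρ = f.eval ρ
  | le e f => e.eval ρ ≤ f.eval ρ
  | lt e f => e.eval ρ < f.eval ρ

def rename (k : ℕ → ℕ) : LinCon → LinCon
  | eq e f => eq (e.rename k) (f.rename k)
  | le e f => le (e.rename k) (f.rename k)
  | lt e f => lt (e.rename k) (f.rename k)

end LinCon

/-- A finite linear system is solvable in the rational numbers. -/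
def LinSolvable (L : List LinCon) : Prop :=
  ∃ ρ : ℕ → ℚ, ∀ c ∈ L, c.Holds ρ

/-- Terms over schematic term variables `mv n`. -/
inductive TSch where
  | mv (n : ℕ)
  | const (c : ℕ)
  | var (x : ℕ)
  | app (s t : TSch)
  | bang (t : TSch)

namespace TSch

def ofTm : Tm → TSch
  | .const c => const c
  | .var x => var x
  | .app s t => app (ofTm s) (ofTm t)
  | .bang t => bang (ofTm t)

def rename (k : ℕ → ℕ) : TSch → TSch
  | mv n => mv (k n)
  | const c => const c
  | var x => var x
  | app s t => app (s.rename k) (t.rename k)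
  | bang t => bang (t.rename k)

/-- Replace the schematic variable `m` by `r`. -/
def subst (m : ℕ) (r : TSch) : TSch → TSch
  | mv n => if n = m then r else mv n
  | const c => const c
  | var x => var x
  | app s t => app (TSch.subst m r s) (TSch.subst m r t)
  | bang t => bang (TSch.subst m r t)

/-- The schematic term variables that occur. -/
def mvs : TSch → Finset ℕ
  | mv n => {n}
  | const _ => ∅
  | var _ => ∅
  | app s t => s.mvs ∪ t.mvs
  | bang t => t.mvs

def size : TSch → ℕ
  | mv _ => 1
  | const _ => 1
  | var _ => 1
  | app s t => s.size + t.size + 1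
  | bang t => t.size + 1

end TSch

/-- Formulas over schematic formula variables `mv n`, schematic terms, and linear expressions
as indices of the probability operators. -/
inductive FSch where
  | mv (n : ℕ)
  | atom (p : ℕ)
  | neg (A : FSch)
  | conj (A B : FSch)
  | just (t : TSch) (A : FSch)
  | prob (e : Lin) (A : FSch)

namespace FSch

def imp (A B : FSch) : FSch := neg (conj A (neg B))

def disj (A B : FSch) : FSch := neg (conj (neg A) (neg B))

def ofFormula : Formula → FSch
  | .atom p => atom p
  | .neg A => neg (ofFormula A)
  | .conj A B => conj (ofFormula A) (ofFormula B)
  | .just t A => just (TSch.ofTm t) (ofFormula A)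
  | .prob s A => prob (.const s.1) (ofFormula A)

def ofPropSchema : PropSchema → FSch
  | .letter n => mv n
  | .neg X => neg (ofPropSchema X)
  | .conj X Y => conj (ofPropSchema X) (ofPropSchema Y)

/-- Rename the schematic variables of all three sorts. -/
def rename (k : ℕ → ℕ) : FSch → FSch
  | mv n => mv (k n)
  | atom p => atom p
  | neg A => neg (A.rename k)
  | conj A B => conj (A.rename k) (B.rename k)
  | just t A => just (t.rename k) (A.rename k)
  | prob e A => prob (e.rename k) (A.rename k)

/-- Replace the schematic formula variable `m` by `R`. -/
def subst (m : ℕ) (R : FSch) : FSch → FSch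
  | mv n => if n = m then R else mv n
  | atom p => atom p
  | neg A => neg (FSch.subst m R A)
  | conj A B => conj (FSch.subst m R A) (FSch.subst m R B)
  | just t A => just t (FSch.subst m R A)
  | prob e A => prob e (FSch.subst m R A)

/-- Replace the schematic term variable `m` by `r`. -/
def substT (m : ℕ) (r : TSch) : FSch → FSch
  | mv n => mv n
  | atom p => atom p
  | neg A => neg (A.substT m r)
  | conj A B => conj (A.substT m r) (B.substT m r)
  | just t A => just (TSch.subst m r t) (A.substT m r)
  | prob e A => prob e (A.substT m r)

/-- The schematic formula variables that occur. -/
def mvs : FSch → Finset ℕ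
  | mv n => {n}
  | atom _ => ∅
  | neg A => A.mvs
  | conj A B => A.mvs ∪ B.mvs
  | just _ A => A.mvs
  | prob _ A => A.mvs

/-- The schematic term variables that occur. -/
def tmvs : FSch → Finset ℕ
  | mv _ => ∅
  | atom _ => ∅
  | neg A => A.tmvs
  | conj A B => A.tmvs ∪ B.tmvs
  | just t A => t.mvs ∪ A.tmvs
  | prob _ A => A.tmvs

def size : FSch → ℕ
  | mv _ => 1
  | atom _ => 1
  | neg A => A.size + 1
  | conj A B => A.size + B.size + 1
  | just t A => t.size + A.size + 1
  | prob _ A => A.size + 1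

end FSch

/-- Equations between schematic formulas, and between schematic terms. -/
inductive Eqn where
  | fm (A B : FSch)
  | tm (s t : TSch)

namespace Eqn

def rename (k : ℕ → ℕ) : Eqn → Eqn
  | fm A B => fm (A.rename k) (B.rename k)
  | tm s t => tm (s.rename k) (t.rename k)

def subst (m : ℕ) (R : FSch) : Eqn → Eqn
  | fm A B => fm (FSch.subst m R A) (FSch.subst m R B)
  | tm s t => tm s t

def substT (m : ℕ) (r : TSch) : Eqn → Eqn
  | fm A B => fm (A.substT m r) (B.substT m r)
  | tm s t => tm (TSch.subst m r s) (TSch.subst m r t)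

def mvs : Eqn → Finset ℕ
  | fm A B => A.mvs ∪ B.mvs
  | tm _ _ => ∅

def tmvs : Eqn → Finset ℕ
  | fm A B => A.tmvs ∪ B.tmvs
  | tm s t => s.mvs ∪ t.mvs

def size : Eqn → ℕ
  | fm A B => A.size + B.size
  | tm s t => s.size + t.size

end Eqn

/-- Solve the equation `m ≐ R` for the formula variable `m` and eliminate `m` from `E`;
fails when `m` occurs properly in `R`. -/
def elimF (m : ℕ) (R : FSch) (E : List Eqn) : Option (List Eqn × List LinCon) :=
  match R with
  | .mv n => if n = m then some (E, []) else some (E.map (Eqn.subst m (.mv n)), [])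
  | R => if m ∈ R.mvs then none else some (E.map (Eqn.subst m R), [])

/-- Solve the equation `m ≐ r` for the term variable `m` and eliminate `m` from `E`;
fails when `m` occurs properly in `r`. -/
def elimT (m : ℕ) (r : TSch) (E : List Eqn) : Option (List Eqn × List LinCon) :=
  match r with
  | .mv n => if n = m then some (E, []) else some (E.map (Eqn.substT m (.mv n)), [])
  | r => if m ∈ r.mvs then none else some (E.map (Eqn.substT m r), [])

/-- One step of the unification algorithm: process one equation in front of the remaining
equations `E`. The result consists of the new equations and of the linear equations produced
by comparing indices of probability operators; `none` means failure. -/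
def unifyStep : Eqn → List Eqn → Option (List Eqn × List LinCon)
  | .fm (.mv m) B, E => elimF m B E
  | .fm A (.mv m), E => elimF m A E
  | .fm (.atom p) (.atom q), E => if p = q then some (E, []) else none
  | .fm (.neg A) (.neg B), E => some (.fm A B :: E, [])
  | .fm (.conj A A₂) (.conj B B₂), E => some (.fm A B :: .fm A₂ B₂ :: E, [])
  | .fm (.just s A) (.just t B), E => some (.tm s t :: .fm A B :: E, [])
  | .fm (.prob e A) (.prob f B), E => some (.fm A B :: E, [.eq e f])
  | .fm _ _, _ => none
  | .tm (.mv m) t, E => elimT m t E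
  | .tm s (.mv m), E => elimT m s E
  | .tm (.const c) (.const d), E => if c = d then some (E, []) else none
  | .tm (.var x) (.var y), E => if x = y then some (E, []) else none
  | .tm (.app s s₂) (.app t t₂), E => some (.tm s t :: .tm s₂ t₂ :: E, [])
  | .tm (.bang s) (.bang t), E => some (.tm s t :: E, [])
  | .tm _ _, _ => none

/-- The schematic formula variables of a list of equations. -/
def eqnMvs : List Eqn → Finset ℕ
  | [] => ∅
  | e :: E => e.mvs ∪ eqnMvs E

/-- The schematic term variables of a list of equations. -/
def eqnTmvs : List Eqn → Finset ℕ
  | [] => ∅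
  | e :: E => e.tmvs ∪ eqnTmvs E

def eqnSize : List Eqn → ℕ
  | [] => 0
  | e :: E => e.size + eqnSize E

/-! The measure that makes the unification algorithm terminate. -/

theorem TSch.mvs_subst (m : ℕ) (r t : TSch) : (TSch.subst m r t).mvs ⊆ t.mvs.erase m ∪ r.mvs := by
  induction t with
  | mv n =>
    by_cases h : n = m
    · simp [TSch.subst, h]
    · intro x hx
      simp [TSch.subst, h, TSch.mvs] at hx ⊢
      subst hx
      exact Or.inl ⟨h, rfl⟩
  | const c => simp [TSch.subst, TSch.mvs]
  | var x => simp [TSch.subst, TSch.mvs]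
  | app s t hs ht => simp only [TSch.subst, TSch.mvs]; grind
  | bang t ht => simpa only [TSch.subst, TSch.mvs] using ht

theorem FSch.mvs_subst (m : ℕ) (R A : FSch) : (FSch.subst m R A).mvs ⊆ A.mvs.erase m ∪ R.mvs := by
  induction A with
  | mv n =>
    by_cases h : n = m
    · simp [FSch.subst, h]
    · intro x hx
      simp [FSch.subst, h, FSch.mvs] at hx ⊢
      subst hx
      exact Or.inl ⟨h, rfl⟩
  | atom p => simp [FSch.subst, FSch.mvs]
  | neg A h => simpa only [FSch.subst, FSch.mvs] using h
  | conj A B hA hB => simp only [FSch.subst, FSch.mvs]; grind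
  | just t A h => simpa only [FSch.subst, FSch.mvs] using h
  | prob e A h => simpa only [FSch.subst, FSch.mvs] using h

theorem FSch.tmvs_subst (m : ℕ) (R A : FSch) : (FSch.subst m R A).tmvs ⊆ A.tmvs ∪ R.tmvs := by
  induction A with
  | mv n =>
    by_cases h : n = m
    · simp [FSch.subst, h]
    · simp [FSch.subst, h, FSch.tmvs]
  | atom p => simp [FSch.subst, FSch.tmvs]
  | neg A h => simpa only [FSch.subst, FSch.tmvs] using h
  | conj A B hA hB => simp only [FSch.subst, FSch.tmvs]; grind
  | just t A h => simp only [FSch.subst, FSch.tmvs]; grind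
  | prob e A h => simpa only [FSch.subst, FSch.tmvs] using h

theorem FSch.mvs_substT (m : ℕ) (r : TSch) (A : FSch) : (A.substT m r).mvs = A.mvs := by
  induction A <;> simp_all [FSch.substT, FSch.mvs]

theorem FSch.tmvs_substT (m : ℕ) (r : TSch) (A : FSch) :
    (A.substT m r).tmvs ⊆ A.tmvs.erase m ∪ r.mvs := by
  induction A with
  | mv n => simp [FSch.substT, FSch.tmvs]
  | atom p => simp [FSch.substT, FSch.tmvs]
  | neg A h => simpa only [FSch.substT, FSch.tmvs] using h
  | conj A B hA hB => simp only [FSch.substT, FSch.tmvs]; grind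
  | just t A h =>
    have h2 := TSch.mvs_subst m r t
    simp only [FSch.substT, FSch.tmvs]; grind
  | prob e A h => simpa only [FSch.substT, FSch.tmvs] using h

theorem eqnMvs_subst (m : ℕ) (R : FSch) (E : List Eqn) :
    eqnMvs (E.map (Eqn.subst m R)) ⊆ (eqnMvs E).erase m ∪ R.mvs := by
  induction E with
  | nil => simp [eqnMvs]
  | cons e E ih =>
    cases e with
    | fm A B =>
      have hA := FSch.mvs_subst m R A
      have hB := FSch.mvs_subst m R B
      simp only [List.map_cons, eqnMvs, Eqn.subst, Eqn.mvs]; grind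
    | tm s t => simp only [List.map_cons, eqnMvs, Eqn.subst, Eqn.mvs]; grind

theorem eqnTmvs_subst (m : ℕ) (R : FSch) (E : List Eqn) :
    eqnTmvs (E.map (Eqn.subst m R)) ⊆ eqnTmvs E ∪ R.tmvs := by
  induction E with
  | nil => simp [eqnTmvs]
  | cons e E ih =>
    cases e with
    | fm A B =>
      have hA := FSch.tmvs_subst m R A
      have hB := FSch.tmvs_subst m R B
      simp only [List.map_cons, eqnTmvs, Eqn.subst, Eqn.tmvs]; grind
    | tm s t => simp only [List.map_cons, eqnTmvs, Eqn.subst, Eqn.tmvs]; grind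

theorem eqnMvs_substT (m : ℕ) (r : TSch) (E : List Eqn) :
    eqnMvs (E.map (Eqn.substT m r)) = eqnMvs E := by
  induction E with
  | nil => simp [eqnMvs]
  | cons e E ih =>
    cases e <;> simp [eqnMvs, Eqn.substT, Eqn.mvs, FSch.mvs_substT, ih]

theorem eqnTmvs_substT (m : ℕ) (r : TSch) (E : List Eqn) :
    eqnTmvs (E.map (Eqn.substT m r)) ⊆ (eqnTmvs E).erase m ∪ r.mvs := by
  induction E with
  | nil => simp [eqnTmvs]
  | cons e E ih =>
    cases e with
    | fm A B =>
      have hA := FSch.tmvs_substT m r A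
      have hB := FSch.tmvs_substT m r B
      simp only [List.map_cons, eqnTmvs, Eqn.substT, Eqn.tmvs]; grind
    | tm s t =>
      have hA := TSch.mvs_subst m r s
      have hB := TSch.mvs_subst m r t
      simp only [List.map_cons, eqnTmvs, Eqn.substT, Eqn.tmvs]; grind

/-- The measure: the number of schematic variables, then the size. -/
def eqnMeasure (E : List Eqn) : ℕ ×ₗ ℕ :=
  toLex ((eqnMvs E).card + (eqnTmvs E).card, eqnSize E)

theorem eqnMeasure_lt_of_subset {E E' : List Eqn} (h₁ : eqnMvs E' ⊆ eqnMvs E)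
    (h₂ : eqnTmvs E' ⊆ eqnTmvs E) (h₃ : eqnSize E' < eqnSize E) :
    eqnMeasure E' < eqnMeasure E := by
  have h := Nat.add_le_add (Finset.card_le_card h₁) (Finset.card_le_card h₂)
  rw [eqnMeasure, eqnMeasure, Prod.Lex.toLex_lt_toLex]
  rcases h.lt_or_eq with h | h
  · exact Or.inl h
  · exact Or.inr ⟨h, h₃⟩

theorem eqnMeasure_lt_of_mvs {E E' : List Eqn} {m : ℕ} (hm : m ∈ eqnMvs E)
    (h₁ : eqnMvs E' ⊆ (eqnMvs E).erase m) (h₂ : eqnTmvs E' ⊆ eqnTmvs E) :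
    eqnMeasure E' < eqnMeasure E := by
  have h₃ := Finset.card_le_card h₁
  have h₄ := Finset.card_le_card h₂
  have h₅ := Finset.card_erase_lt_of_mem hm
  rw [eqnMeasure, eqnMeasure, Prod.Lex.toLex_lt_toLex]
  left
  simp only
  omega

theorem eqnMeasure_lt_of_tmvs {E E' : List Eqn} {m : ℕ} (hm : m ∈ eqnTmvs E)
    (h₁ : eqnMvs E' ⊆ eqnMvs E) (h₂ : eqnTmvs E' ⊆ (eqnTmvs E).erase m) :
    eqnMeasure E' < eqnMeasure E := by
  have h₃ := Finset.card_le_card h₁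
  have h₄ := Finset.card_le_card h₂
  have h₅ := Finset.card_erase_lt_of_mem hm
  rw [eqnMeasure, eqnMeasure, Prod.Lex.toLex_lt_toLex]
  left
  simp only
  omega

theorem FSch.size_pos (A : FSch) : 0 < A.size := by
  cases A <;> simp [FSch.size]

theorem TSch.size_pos (t : TSch) : 0 < t.size := by
  cases t <;> simp [TSch.size]

theorem elimF_measure {m : ℕ} {R : FSch} {e : Eqn} {E : List Eqn}
    {p : List Eqn × List LinCon} (h : elimF m R E = some p)
    (he : e = .fm (.mv m) R ∨ e = .fm R (.mv m)) : eqnMeasure p.1 < eqnMeasure (e :: E) := by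
  have hv : eqnMvs (e :: E) = {m} ∪ R.mvs ∪ eqnMvs E := by
    rcases he with rfl | rfl <;> simp only [eqnMvs, Eqn.mvs, FSch.mvs]
    grind
  have ht : eqnTmvs (e :: E) = R.tmvs ∪ eqnTmvs E := by
    rcases he with rfl | rfl <;> simp [eqnTmvs, Eqn.tmvs, FSch.tmvs]
  have hs : eqnSize E < eqnSize (e :: E) := by
    rcases he with rfl | rfl <;> simp only [eqnSize, Eqn.size, FSch.size] <;> omega
  have key : m ∉ R.mvs →
      eqnMeasure (E.map (Eqn.subst m R)) < eqnMeasure (e :: E) := by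
    intro hm
    have h1 := eqnMvs_subst m R E
    have h2 := eqnTmvs_subst m R E
    refine eqnMeasure_lt_of_mvs (m := m) ?_ ?_ ?_
    · rw [hv]; grind
    · rw [hv]; grind
    · rw [ht]; grind
  have key2 : eqnMeasure E < eqnMeasure (e :: E) := by
    refine eqnMeasure_lt_of_subset ?_ ?_ hs
    · rw [hv]; grind
    · rw [ht]; grind
  unfold elimF at h
  split at h
  · rename_i n
    split at h
    · cases h; exact key2
    · rename_i hn
      cases h
      exact key (by simp only [FSch.mvs, Finset.mem_singleton]; exact fun h => hn h.symm)
  · split at h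
    · cases h
    · rename_i hn
      cases h
      exact key hn

theorem elimT_measure {m : ℕ} {r : TSch} {e : Eqn} {E : List Eqn}
    {p : List Eqn × List LinCon} (h : elimT m r E = some p)
    (he : e = .tm (.mv m) r ∨ e = .tm r (.mv m)) : eqnMeasure p.1 < eqnMeasure (e :: E) := by
  have hv : eqnMvs (e :: E) = eqnMvs E := by
    rcases he with rfl | rfl <;> simp [eqnMvs, Eqn.mvs]
  have ht : eqnTmvs (e :: E) = {m} ∪ r.mvs ∪ eqnTmvs E := by
    rcases he with rfl | rfl <;> simp only [eqnTmvs, Eqn.tmvs, TSch.mvs]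
    grind
  have hs : eqnSize E < eqnSize (e :: E) := by
    rcases he with rfl | rfl <;> simp only [eqnSize, Eqn.size, TSch.size] <;> omega
  have key : m ∉ r.mvs →
      eqnMeasure (E.map (Eqn.substT m r)) < eqnMeasure (e :: E) := by
    intro hm
    have h1 := eqnMvs_substT m r E
    have h2 := eqnTmvs_substT m r E
    refine eqnMeasure_lt_of_tmvs (m := m) ?_ ?_ ?_
    · rw [ht]; grind
    · rw [hv, h1]
    · rw [ht]; grind
  have key2 : eqnMeasure E < eqnMeasure (e :: E) := by
    refine eqnMeasure_lt_of_subset ?_ ?_ hs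
    · rw [hv]
    · rw [ht]; grind
  unfold elimT at h
  split at h
  · rename_i n
    split at h
    · cases h; exact key2
    · rename_i hn
      cases h
      exact key (by simp only [TSch.mvs, Finset.mem_singleton]; exact fun h => hn h.symm)
  · split at h
    · cases h
    · rename_i hn
      cases h
      exact key hn

theorem unifyStep_measure {e : Eqn} {E : List Eqn} {p : List Eqn × List LinCon}
    (h : unifyStep e E = some p) : eqnMeasure p.1 < eqnMeasure (e :: E) := by
  unfold unifyStep at h
  split at h
  case h_1 => exact elimF_measure h (Or.inl rfl)
  case h_2 => exact elimF_measure h (Or.inr rfl)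
  case h_9 => exact elimT_measure h (Or.inl rfl)
  case h_10 => exact elimT_measure h (Or.inr rfl)
  all_goals
    try split at h
    all_goals first
      | cases h
        refine eqnMeasure_lt_of_subset ?_ ?_ ?_ <;>
          simp only [eqnMvs, eqnTmvs, eqnSize, Eqn.mvs, Eqn.tmvs, Eqn.size, FSch.mvs, FSch.tmvs,
            FSch.size, TSch.mvs, TSch.size] <;> first | omega | grind
      | simp at h

/-- The unification algorithm. It returns `none` if it fails, and otherwise the linear equations
that remain to be satisfied. -/
def unify : List Eqn → Option (List LinCon)
  | [] => some []
  | e :: E =>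
    match h : unifyStep e E with
    | none => none
    | some (E', L) => (unify E').map (L ++ ·)
termination_by E => eqnMeasure E
decreasing_by exact unifyStep_measure h

/-! ## Checking justification constraints -/

/-- A candidate: a schematic formula, subject to equations that have to be unified and to a
linear system. It stands for the formulas that arise from `head` by those substitutions that
solve the equations and the linear system. -/
structure Cand where
  head : FSch
  eqs : List Eqn
  lin : List LinCon

def Cand.rename (k : ℕ → ℕ) (X : Cand) : Cand :=
  ⟨X.head.rename k, X.eqs.map (Eqn.rename k), X.lin.map (LinCon.rename k)⟩

/-- `A` unifies with the candidate `X`: unification of all equations succeeds, and the linear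
equations that it produces are solvable together with the linear side conditions. -/
def Cand.Matches (X : Cand) (A : Formula) : Prop :=
  ∃ L, unify (.fm X.head (FSch.ofFormula A) :: X.eqs) = some L ∧ LinSolvable (L ++ X.lin)

/-- Modus ponens on candidates: with variables renamed apart, unify the head of `X` with the
implication from the head of `Y` to a fresh formula variable. -/
def Cand.mp (X Y : Cand) : Cand :=
  let X' := X.rename (fun n => 3 * n + 1)
  let Y' := Y.rename (fun n => 3 * n + 2)
  ⟨.mv 0, .fm X'.head (.imp Y'.head (.mv 0)) :: (X'.eqs ++ Y'.eqs), X'.lin ++ Y'.lin⟩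

/-- The linear conditions `0 ≤ e ≤ 1`. -/
def Lin.inUnit (e : Lin) : List LinCon := [.le (.const 0) e, .le e (.const 1)]

def FSch.probLt (e : Lin) (A : FSch) : FSch := .neg (.prob e A)

def FSch.probLe (e : Lin) (A : FSch) : FSch := .prob (.sub (.const 1) e) (.neg A)

/-- The axiom schemata with their linear side conditions. The schema with the index
`min (1, r + s)` is split into two schemata with linear indices. -/
def axiomCands (Γ : List PropSchema) : List Cand :=
  let A : FSch := .mv 0
  let B : FSch := .mv 1
  let s : TSch := .mv 0
  let t : TSch := .mv 1
  let p : Lin := .var 0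
  let q : Lin := .var 1
  let one : Lin := .const 1
  Γ.map (fun X => ⟨FSch.ofPropSchema X, [], []⟩) ++
  [ ⟨.prob (.const 0) A, [], []⟩,
    ⟨.imp (.probLe p A) (.probLt q A), [], p.inUnit ++ q.inUnit ++ [.lt p q]⟩,
    ⟨.imp (.probLt p A) (.probLe p A), [], p.inUnit⟩,
    ⟨.imp (.conj (.conj (.prob p A) (.prob q B)) (.prob one (.neg (.conj A B))))
        (.prob (.add p q) (.disj A B)), [],
      p.inUnit ++ q.inUnit ++ [.le (.add p q) one]⟩,
    ⟨.imp (.conj (.conj (.prob p A) (.prob q B)) (.prob one (.neg (.conj A B))))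
        (.prob one (.disj A B)), [],
      p.inUnit ++ q.inUnit ++ [.le one (.add p q)]⟩,
    ⟨.imp (.conj (.probLe p A) (.probLt q B)) (.probLt (.add p q) (.disj A B)), [],
      p.inUnit ++ q.inUnit ++ [.le (.add p q) one]⟩,
    ⟨.imp (.just s (.imp A B)) (.imp (.just t A) (.just (.app s t) B)), [], []⟩ ]

/-- The schemata `!ⁿ⁻¹ c : ⋯ : c : A`, with `A` an axiom schema, for the term `!ⁿ c`; there are
none for a term of another form. -/
def constCands (Γ : List PropSchema) : Tm → List Cand
  | .const _ => axiomCands Γ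
  | .bang t => (constCands Γ t).map fun X => ⟨.just (TSch.ofTm t) X.head, X.eqs, X.lin⟩
  | .var _ => []
  | .app _ _ => []

/-- A formula with the sign `T` (`true`) or `F` (`false`). -/
abbrev Signed : Type := Bool × Formula

/-- A branch: the signed formulas that occur on it. All of them belong to one world. -/
abbrev Branch : Type := List Signed

/-- The formulas `B` such that `T t : B` is on the branch. -/
def Branch.assumptions (b : Branch) (t : Tm) : List Formula :=
  b.filterMap fun
    | (true, .just s B) => if s = t then some B else none
    | _ => none

/-- Candidates for the formulas in `evid t`, where `evid` belongs to the minimum `M`-model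
determined by the formulas `s : B` with `T s : B` on the branch. -/
def Branch.cands (Γ : List PropSchema) (b : Branch) : Tm → List Cand
  | .const c => (b.assumptions (.const c)).map (fun B => ⟨FSch.ofFormula B, [], []⟩) ++
      constCands Γ (.const c)
  | .var x => (b.assumptions (.var x)).map (fun B => ⟨FSch.ofFormula B, [], []⟩)
  | .bang t => (b.assumptions (.bang t)).map (fun B => ⟨FSch.ofFormula B, [], []⟩) ++
      constCands Γ (.bang t)
  | .app s t => (b.assumptions (.app s t)).map (fun B => ⟨FSch.ofFormula B, [], []⟩) ++
      (Branch.cands Γ b s).flatMap fun X => (Branch.cands Γ b t).map fun Y => X.mp Y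

/-- The justification constraints of the branch hold: for no `F t : A` on the branch does `A`
unify with a candidate for `t`. -/
def Branch.JustCheck (Γ : List PropSchema) (b : Branch) : Prop :=
  ∀ (t : Tm) (A : Formula), (false, .just t A) ∈ b → ∀ X ∈ b.cands Γ t, ¬ X.Matches A

/-! ## Tableaux -/

def Branch.Closed (b : Branch) : Prop := ∃ A, (true, A) ∈ b ∧ (false, A) ∈ b

/-- The possible applications of rules to the end of a branch, described by what they add:
a non-branching propositional rule adds signed formulas, a branching one splits the branch, and
the probabilistic rule creates one new world for every choice of signs of `B 0, …, B (m - 1)`. -/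
inductive RuleApp where
  | ext (S : List Signed)
  | split (X Y : Signed)
  | prob (m : ℕ) (B : Fin m → Formula)

/-- The branches below a rule application. -/
abbrev RuleApp.Idx : RuleApp → Type
  | ext _ => Unit
  | split _ _ => Bool
  | prob m _ => Fin m → Bool

/-- The conjunction of a list of formulas (of no interest for the empty list). -/
def bigConj : List Formula → Formula
  | [] => .neg (.conj (.atom 0) (.neg (.atom 0)))
  | [A] => A
  | A :: B :: l => .conj A (bigConj (B :: l))

/-- The atom `± B 0 ∧ ⋯ ∧ ± B (m - 1)` with signs `ε`. -/
def atomOf {m : ℕ} (B : Fin m → Formula) (ε : Fin m → Bool) : Formula :=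
  bigConj (List.ofFn fun j => if ε j then B j else .neg (B j))

/-- The branches that result from a rule application at the end of the branch `b`. -/
def RuleApp.result (b : Branch) : (r : RuleApp) → r.Idx → Branch
  | ext S, _ => S ++ b
  | split X Y, i => (if i then X else Y) :: b
  | prob _ B, ε => [(true, atomOf B ε)]

/-- The propositional rules. A rule is applicable only if it adds something new. -/
inductive PropApplicable (b : Branch) : RuleApp → Prop
  | negT (A : Formula) : (true, .neg A) ∈ b → (false, A) ∉ b → PropApplicable b (.ext [(false, A)])
  | negF (A : Formula) : (false, .neg A) ∈ b → (true, A) ∉ b → PropApplicable b (.ext [(true, A)])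
  | conjT (A B : Formula) : (true, .conj A B) ∈ b → ¬ ((true, A) ∈ b ∧ (true, B) ∈ b) →
      PropApplicable b (.ext [(true, A), (true, B)])
  | conjF (A B : Formula) : (false, .conj A B) ∈ b → (false, A) ∉ b → (false, B) ∉ b →
      PropApplicable b (.split (false, A) (false, B))

/-- The probabilistic rule, for open branches to which no propositional rule applies and on
which some probabilistic formula occurs: `B` enumerates without repetition the formulas `C` for
which `T P_{≥ s} C` or `F P_{≥ s} C` is on the branch for some `s`. -/
def ProbApplicable (b : Branch) (m : ℕ) (B : Fin m → Formula) : Prop :=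
  ¬ b.Closed ∧ (∀ r, ¬ PropApplicable b r) ∧ 0 < m ∧ Function.Injective B ∧
    ∀ C, (∃ j, B j = C) ↔ ∃ (sgn : Bool) (s : Rat01), (sgn, .prob s C) ∈ b

inductive Applicable (b : Branch) : RuleApp → Prop
  | propositional (r : RuleApp) : PropApplicable b r → Applicable b r
  | probabilistic (m : ℕ) (B : Fin m → Formula) : ProbApplicable b m B → Applicable b (.prob m B)

/-- A branch is complete if no rule is applicable. -/
def Branch.Complete (b : Branch) : Prop := ∀ r, ¬ Applicable b r

/-- The branch `b'` is obtained from `b` by one application of a rule. -/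
def Expands (b' b : Branch) : Prop := ∃ r, Applicable b r ∧ ∃ i : r.Idx, b' = r.result b i

/-- Trees of rule applications. The subtree at a child of an application of the probabilistic
rule is the tableau of the new world created there. -/
inductive Tableau where
  | leaf
  | node (r : RuleApp) (child : r.Idx → Tableau)

/-- `IsTableau b T`: the tree `T` is a fully developed tableau that continues the branch `b`. -/
inductive IsTableau : Branch → Tableau → Prop
  | leaf (b : Branch) : b.Closed ∨ b.Complete → IsTableau b .leaf
  | node (b : Branch) (r : RuleApp) (child : r.Idx → Tableau) : Applicable b r →
      (∀ i, IsTableau (r.result b i) (child i)) → IsTableau b (.node r child)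

/-! ## Marking -/

/-- The linear system of an application of the probabilistic rule to the branch `b`, where
`mark ε` says that the new world with signs `ε` is marked satisfiable, is solvable. -/
def ProbSystemSolvable (b : Branch) {m : ℕ} (B : Fin m → Formula)
    (mark : (Fin m → Bool) → Prop) : Prop :=
  ∃ x : (Fin m → Bool) → ℝ,
    ∑ ε, x ε = 1 ∧
    (∀ ε, 0 ≤ x ε) ∧
    (∀ ε, ¬ mark ε → x ε = 0) ∧
    (∀ (s : Rat01) (j : Fin m), (true, .prob s (B j)) ∈ b →
      ((s.1 : ℚ) : ℝ) ≤ ∑ ε with ε j = true, x ε) ∧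
    (∀ (s : Rat01) (j : Fin m), (false, .prob s (B j)) ∈ b →
      ∑ ε with ε j = true, x ε < ((s.1 : ℚ) : ℝ))

/-- The marking procedure, from the leaves to the root. For a branch `b` of a world `w` and the
tree `T` below it, `T.Marked Γ b` says that some branch of `w` that extends `b` is open, passes
the check of the justification constraints, and is complete or ends in an application of the
probabilistic rule that is marked satisfiable. When `b` is the initial part of the branches
of `w`, this says that `w` is marked satisfiable. -/
def Tableau.Marked (Γ : List PropSchema) : Tableau → Branch → Prop
  | leaf, b => ¬ b.Closed ∧ b.JustCheck Γ ∧ b.Complete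
  | node (.ext S) child, b =>
      (child ()).Marked Γ ((RuleApp.ext S).result b ())
  | node (.split X Y) child, b =>
      ∃ i : Bool, (child i).Marked Γ ((RuleApp.split X Y).result b i)
  | node (.prob m B) child, b =>
      ¬ b.Closed ∧ b.JustCheck Γ ∧
        ProbSystemSolvable b B fun ε => (child ε).Marked Γ ((RuleApp.prob m B).result b ε)

/-- The branch that consists of the root `T A`. -/
def rootBranch (A : Formula) : Branch := [(true, A)]

/-- The procedure returns that `A` is satisfiable, when run to the tableau `T` for `A`. -/
def ReturnsSatisfiable (Γ : List PropSchema) (A : Formula) (T : Tableau) : Prop :=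
  T.Marked Γ (rootBranch A)

end PPJ

namespace PPJ

/-! ## Semantics of schemata and correctness of unification -/

/-! The core is an induction on fully developed tableaux (`IsTableau.marked_iff`): the tree below a
branch is marked exactly when some world of some measurable model gives every formula of the branch
the truth value of its sign. The right side does not depend on the tree, so the order of the rules
is irrelevant. Propositional rules preserve the right side exactly; the substance lies in the
justification check and in the probabilistic rule.

Justifications. A candidate denotes the formulas obtained by solving its equations and its linear
system. Unification preserves solutions in both directions over each fixed rational assignment.
Indices are clamped to `[0,1]`, where clamping is injective, and the side conditions force all
indices of candidates into that interval (`Cand.Bounded`). So matching a formula means denoting it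
(`Cand.Bounded.matches_iff`). The formulas denoted by the candidates of a branch form the least
evidence function that contains its `T`-justifications. The check passes exactly when this function
contains none of the `F`-justifications; if it fails, no M-model respects the signs.

Probabilities. The conjunctions of the `± B j` partition the worlds. In a model of the branch their
measures solve the linear system, and conjunctions that are unsatisfiable get measure zero.
Conversely, given a solution, models of the satisfiable conjunctions are put side by side under a
new world whose space weights their chosen worlds by the solution (`Model.graft`).

Termination. Inside one world every propositional rule adds a new signed formula from a finite set;
the probabilistic rule lowers the nesting depth of probability operators. -/

/-- The point of `[0,1]` nearest to `q`. -/
def Rat01.clamp (q : ℚ) : Rat01 :=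
  ⟨max 0 (min 1 q), le_max_left _ _, max_le zero_le_one (min_le_left _ _)⟩

theorem Rat01.coe_clamp {q : ℚ} (h₀ : 0 ≤ q) (h₁ : q ≤ 1) : (Rat01.clamp q).1 = q := by
  simp [Rat01.clamp, h₀, h₁]

theorem Rat01.clamp_coe (s : Rat01) : Rat01.clamp s.1 = s :=
  Subtype.ext (Rat01.coe_clamp s.2.1 s.2.2)

/-- An assignment of values to the schematic variables of the three sorts. -/
structure Assignment where
  fm : ℕ → Formula
  tm : ℕ → Tm
  rat : ℕ → ℚ

/-- The term denoted by a schematic term. -/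
def TSch.eval (g : ℕ → Tm) : TSch → Tm
  | mv n => g n
  | const c => .const c
  | var x => .var x
  | app s t => .app (s.eval g) (t.eval g)
  | bang t => .bang (t.eval g)

/-- The formula denoted by a schematic formula; indices are projected to `[0,1]`. -/
def FSch.eval (θ : Assignment) : FSch → Formula
  | mv n => θ.fm n
  | atom p => .atom p
  | neg A => .neg (A.eval θ)
  | conj A B => .conj (A.eval θ) (B.eval θ)
  | just t A => .just (t.eval θ.tm) (A.eval θ)
  | prob e A => .prob (Rat01.clamp (e.eval θ.rat)) (A.eval θ)

/-- All indices of probability operators take values in `[0,1]`. -/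
def FSch.InUnit (ρ : ℕ → ℚ) : FSch → Prop
  | mv _ => True
  | atom _ => True
  | neg A => A.InUnit ρ
  | conj A B => A.InUnit ρ ∧ B.InUnit ρ
  | just _ A => A.InUnit ρ
  | prob e A => (0 ≤ e.eval ρ ∧ e.eval ρ ≤ 1) ∧ A.InUnit ρ

/-- The assignment solves the equation. -/
def Eqn.Holds (θ : Assignment) : Eqn → Prop
  | fm A B => A.eval θ = B.eval θ
  | tm s t => s.eval θ.tm = t.eval θ.tm

def Eqn.InUnit (ρ : ℕ → ℚ) : Eqn → Prop
  | fm A B => A.InUnit ρ ∧ B.InUnit ρ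
  | tm _ _ => True

theorem TSch.eval_ofTm (g : ℕ → Tm) (t : Tm) : (TSch.ofTm t).eval g = t := by
  induction t <;> simp_all [TSch.ofTm, TSch.eval]

theorem FSch.eval_ofFormula (θ : Assignment) (A : Formula) : (FSch.ofFormula A).eval θ = A := by
  induction A <;>
    simp_all [FSch.ofFormula, FSch.eval, TSch.eval_ofTm, Lin.eval, Rat01.clamp_coe]

theorem FSch.inUnit_ofFormula (ρ : ℕ → ℚ) (A : Formula) : (FSch.ofFormula A).InUnit ρ := by
  induction A with
  | prob s A h => exact ⟨s.2, h⟩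
  | _ => simp_all [FSch.ofFormula, FSch.InUnit]

/-! ### Substitution -/

theorem TSch.eval_subst (g : ℕ → Tm) (m : ℕ) (r t : TSch) :
    (TSch.subst m r t).eval g = t.eval (Function.update g m (r.eval g)) := by
  induction t with
  | mv n => by_cases h : n = m <;> simp [TSch.subst, TSch.eval, h]
  | _ => simp_all [TSch.subst, TSch.eval]

theorem FSch.eval_subst (θ : Assignment) (m : ℕ) (R A : FSch) :
    (FSch.subst m R A).eval θ =
      A.eval { θ with fm := Function.update θ.fm m (R.eval θ) } := by
  induction A with
  | mv n => by_cases h : n = m <;> simp [FSch.subst, FSch.eval, h]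
  | _ => simp_all [FSch.subst, FSch.eval]

theorem FSch.eval_substT (θ : Assignment) (m : ℕ) (r : TSch) (A : FSch) :
    (A.substT m r).eval θ =
      A.eval { θ with tm := Function.update θ.tm m (r.eval θ.tm) } := by
  induction A <;> simp_all [FSch.substT, FSch.eval, TSch.eval_subst]

theorem FSch.inUnit_subst {ρ : ℕ → ℚ} {m : ℕ} {R A : FSch} (hR : R.InUnit ρ)
    (hA : A.InUnit ρ) : (FSch.subst m R A).InUnit ρ := by
  induction A with
  | mv n => by_cases h : n = m <;> simp [FSch.subst, FSch.InUnit, h, hR]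
  | _ => simp_all [FSch.subst, FSch.InUnit]

theorem FSch.inUnit_substT {ρ : ℕ → ℚ} {m : ℕ} {r : TSch} {A : FSch}
    (hA : A.InUnit ρ) : (A.substT m r).InUnit ρ := by
  induction A <;> simp_all [FSch.substT, FSch.InUnit]

theorem Eqn.holds_subst (θ : Assignment) (m : ℕ) (R : FSch) (e : Eqn) :
    (e.subst m R).Holds θ ↔
      e.Holds { θ with fm := Function.update θ.fm m (R.eval θ) } := by
  cases e <;> simp [Eqn.subst, Eqn.Holds, FSch.eval_subst]

theorem Eqn.holds_substT (θ : Assignment) (m : ℕ) (r : TSch) (e : Eqn) :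
    (e.substT m r).Holds θ ↔
      e.Holds { θ with tm := Function.update θ.tm m (r.eval θ.tm) } := by
  cases e <;> simp [Eqn.substT, Eqn.Holds, FSch.eval_substT, TSch.eval_subst]

theorem Eqn.inUnit_subst {ρ : ℕ → ℚ} {m : ℕ} {R : FSch} {e : Eqn} (hR : R.InUnit ρ)
    (he : e.InUnit ρ) : (e.subst m R).InUnit ρ := by
  cases e with
  | fm A B => exact ⟨FSch.inUnit_subst hR he.1, FSch.inUnit_subst hR he.2⟩
  | tm s t => trivial

theorem Eqn.inUnit_substT {ρ : ℕ → ℚ} {m : ℕ} {r : TSch} {e : Eqn}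
    (he : e.InUnit ρ) : (e.substT m r).InUnit ρ := by
  cases e with
  | fm A B => exact ⟨FSch.inUnit_substT he.1, FSch.inUnit_substT he.2⟩
  | tm s t => trivial

/-! ### Values do not depend on variables that do not occur -/

theorem TSch.eval_update_of_notMem (g : ℕ → Tm) {m : ℕ} (u : Tm) {t : TSch} (h : m ∉ t.mvs) :
    t.eval (Function.update g m u) = t.eval g := by
  induction t with
  | mv n =>
    have : n ≠ m := fun e => h (by simp [TSch.mvs, e])
    simp [TSch.eval, this]
  | _ => simp_all [TSch.mvs, TSch.eval]

theorem FSch.eval_update_of_notMem (θ : Assignment) {m : ℕ} (C : Formula) {A : FSch}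
    (h : m ∉ A.mvs) : A.eval { θ with fm := Function.update θ.fm m C } = A.eval θ := by
  induction A with
  | mv n =>
    have : n ≠ m := fun e => h (by simp [FSch.mvs, e])
    simp [FSch.eval, this]
  | _ => simp_all [FSch.mvs, FSch.eval]

/-! ### Occurs check -/

theorem TSch.size_le_size_eval (g : ℕ → Tm) {m : ℕ} {t : TSch} (h : m ∈ t.mvs) :
    (TSch.ofTm (g m)).size ≤ (TSch.ofTm (t.eval g)).size := by
  induction t with
  | mv n => simp_all [TSch.mvs, TSch.eval]
  | const c => simp [TSch.mvs] at h
  | var x => simp [TSch.mvs] at h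
  | app s t hs ht =>
    simp only [TSch.mvs, Finset.mem_union] at h
    simp only [TSch.eval, TSch.ofTm, TSch.size]
    rcases h with h | h
    · have := hs h; omega
    · have := ht h; omega
  | bang t ht =>
    have := ht h
    simp only [TSch.eval, TSch.ofTm, TSch.size]
    omega

/-- A variable that occurs properly in a schematic term has a value strictly smaller than that of
the term. This justifies failure at the occurs check. -/
theorem TSch.eq_mv_of_eval_eq (g : ℕ → Tm) {m : ℕ} {t : TSch} (h : m ∈ t.mvs)
    (he : g m = t.eval g) : t = mv m := by
  have hs := congrArg (fun t => (TSch.ofTm t).size) he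
  cases t with
  | mv n => simp_all [TSch.mvs]
  | const c => simp [TSch.mvs] at h
  | var x => simp [TSch.mvs] at h
  | app s t =>
    simp only [TSch.mvs, Finset.mem_union] at h
    simp only [TSch.eval, TSch.ofTm, TSch.size] at hs
    rcases h with h | h
    · have := TSch.size_le_size_eval g h; omega
    · have := TSch.size_le_size_eval g h; omega
  | bang t =>
    have := TSch.size_le_size_eval (t := t) g h
    simp only [TSch.eval, TSch.ofTm, TSch.size] at hs
    omega

theorem FSch.size_le_size_eval (θ : Assignment) {m : ℕ} {A : FSch} (h : m ∈ A.mvs) :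
    (FSch.ofFormula (θ.fm m)).size ≤ (FSch.ofFormula (A.eval θ)).size := by
  induction A with
  | mv n => simp_all [FSch.mvs, FSch.eval]
  | atom p => simp [FSch.mvs] at h
  | conj A B hA hB =>
    simp only [FSch.mvs, Finset.mem_union] at h
    simp only [FSch.eval, FSch.ofFormula, FSch.size]
    rcases h with h | h
    · have := hA h; omega
    · have := hB h; omega
  | neg A hA | just t A hA | prob e A hA =>
    have := hA h
    simp only [FSch.eval, FSch.ofFormula, FSch.size]
    omega

theorem FSch.eq_mv_of_eval_eq (θ : Assignment) {m : ℕ} {A : FSch} (h : m ∈ A.mvs)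
    (he : θ.fm m = A.eval θ) : A = mv m := by
  have hs := congrArg (fun A => (FSch.ofFormula A).size) he
  cases A with
  | mv n => simp_all [FSch.mvs]
  | atom p => simp [FSch.mvs] at h
  | conj A B =>
    simp only [FSch.mvs, Finset.mem_union] at h
    simp only [FSch.eval, FSch.ofFormula, FSch.size] at hs
    rcases h with h | h
    · have := FSch.size_le_size_eval θ h; omega
    · have := FSch.size_le_size_eval θ h; omega
  | neg A | just t A | prob e A =>
    have := FSch.size_le_size_eval (A := A) θ h
    simp only [FSch.eval, FSch.ofFormula, FSch.size] at hs
    omega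

/-! ### The steps of the algorithm -/

/-- Separates the trivial equation, the occurs-check failure and the genuine elimination, so that
later proofs need not unfold the pattern match. -/
theorem elimF_eq (m : ℕ) (R : FSch) (E : List Eqn) :
    (R = .mv m ∧ elimF m R E = some (E, [])) ∨
    (R ≠ .mv m ∧ m ∈ R.mvs ∧ elimF m R E = none) ∨
    (m ∉ R.mvs ∧ elimF m R E = some (E.map (Eqn.subst m R), [])) := by
  unfold elimF
  split
  · rename_i n
    by_cases h : n = m
    · simp [h]
    · right; right
      simp [h, FSch.mvs, Ne.symm h]
  · rename_i hR
    by_cases h : m ∈ R.mvs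
    · exact Or.inr (Or.inl ⟨hR m, h, by simp [h]⟩)
    · exact Or.inr (Or.inr ⟨h, by simp [h]⟩)

theorem elimT_eq (m : ℕ) (r : TSch) (E : List Eqn) :
    (r = .mv m ∧ elimT m r E = some (E, [])) ∨
    (r ≠ .mv m ∧ m ∈ r.mvs ∧ elimT m r E = none) ∨
    (m ∉ r.mvs ∧ elimT m r E = some (E.map (Eqn.substT m r), [])) := by
  unfold elimT
  split
  · rename_i n
    by_cases h : n = m
    · simp [h]
    · right; right
      simp [h, TSch.mvs, Ne.symm h]
  · rename_i hR
    by_cases h : m ∈ r.mvs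
    · exact Or.inr (Or.inl ⟨hR m, h, by simp [h]⟩)
    · exact Or.inr (Or.inr ⟨h, by simp [h]⟩)

/-- The equations `E` have a solution over the rational assignment `ρ`. -/
def EqnsSolvable (ρ : ℕ → ℚ) (E : List Eqn) : Prop :=
  ∃ θ : Assignment, θ.rat = ρ ∧ ∀ e ∈ E, e.Holds θ

theorem elimF_sound {m : ℕ} {R : FSch} {E : List Eqn} {p : List Eqn × List LinCon}
    (h : elimF m R E = some p) {ρ : ℕ → ℚ} (hp : EqnsSolvable ρ p.1) :
    ∃ θ : Assignment, θ.rat = ρ ∧ θ.fm m = R.eval θ ∧ ∀ e ∈ E, e.Holds θ := by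
  obtain ⟨θ, hθ, hE⟩ := hp
  rcases elimF_eq m R E with ⟨rfl, h'⟩ | ⟨-, -, h'⟩ | ⟨hm, h'⟩
  · rw [h'] at h
    cases h
    exact ⟨θ, hθ, rfl, hE⟩
  · simp [h'] at h
  · rw [h'] at h
    cases h
    -- A solution of the substituted equations is corrected at `m`; since `m` does not occur in `R`,
    -- the correction leaves the value of `R` unchanged.
    refine ⟨{ θ with fm := Function.update θ.fm m (R.eval θ) }, hθ, ?_, fun e he => ?_⟩
    · rw [FSch.eval_update_of_notMem θ _ hm]
      simp
    · exact (Eqn.holds_subst θ m R e).1 (hE _ (List.mem_map_of_mem he))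

theorem elimT_sound {m : ℕ} {r : TSch} {E : List Eqn} {p : List Eqn × List LinCon}
    (h : elimT m r E = some p) {ρ : ℕ → ℚ} (hp : EqnsSolvable ρ p.1) :
    ∃ θ : Assignment, θ.rat = ρ ∧ θ.tm m = r.eval θ.tm ∧ ∀ e ∈ E, e.Holds θ := by
  obtain ⟨θ, hθ, hE⟩ := hp
  rcases elimT_eq m r E with ⟨rfl, h'⟩ | ⟨-, -, h'⟩ | ⟨hm, h'⟩
  · rw [h'] at h
    cases h
    exact ⟨θ, hθ, rfl, hE⟩
  · simp [h'] at h
  · rw [h'] at h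
    cases h
    refine ⟨{ θ with tm := Function.update θ.tm m (r.eval θ.tm) }, hθ, ?_, fun e he => ?_⟩
    · simp [TSch.eval_update_of_notMem θ.tm _ hm]
    · exact (Eqn.holds_substT θ m r e).1 (hE _ (List.mem_map_of_mem he))

theorem elimF_complete {m : ℕ} {R : FSch} {E : List Eqn} {θ : Assignment}
    (hm : θ.fm m = R.eval θ) (hE : ∀ e ∈ E, e.Holds θ) (hR : R.InUnit θ.rat)
    (hu : ∀ e ∈ E, e.InUnit θ.rat) :
    ∃ E', elimF m R E = some (E', []) ∧ (∀ e ∈ E', e.Holds θ) ∧ ∀ e ∈ E', e.InUnit θ.rat := by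
  rcases elimF_eq m R E with ⟨-, h'⟩ | ⟨hne, hmem, -⟩ | ⟨-, h'⟩
  · exact ⟨E, h', hE, hu⟩
  · exact absurd (FSch.eq_mv_of_eval_eq θ hmem hm) hne
  · refine ⟨_, h', ?_, ?_⟩ <;> simp only [List.mem_map] <;> rintro _ ⟨e, he, rfl⟩
    -- `θ` already gives `m` the value of `R`, so the update is the identity.
    · rw [Eqn.holds_subst, ← hm, Function.update_eq_self]
      exact hE e he
    · exact Eqn.inUnit_subst hR (hu e he)

theorem elimT_complete {m : ℕ} {r : TSch} {E : List Eqn} {θ : Assignment}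
    (hm : θ.tm m = r.eval θ.tm) (hE : ∀ e ∈ E, e.Holds θ)
    (hu : ∀ e ∈ E, e.InUnit θ.rat) :
    ∃ E', elimT m r E = some (E', []) ∧ (∀ e ∈ E', e.Holds θ) ∧ ∀ e ∈ E', e.InUnit θ.rat := by
  rcases elimT_eq m r E with ⟨-, h'⟩ | ⟨hne, hmem, -⟩ | ⟨-, h'⟩
  · exact ⟨E, h', hE, hu⟩
  · exact absurd (TSch.eq_mv_of_eval_eq θ.tm hmem hm) hne
  · refine ⟨_, h', ?_, ?_⟩ <;> simp only [List.mem_map] <;> rintro _ ⟨e, he, rfl⟩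
    · rw [Eqn.holds_substT, ← hm, Function.update_eq_self]
      exact hE e he
    · exact Eqn.inUnit_substT (hu e he)

/-- Rational variables are never substituted, and index equations are only collected, so one `ρ`
serves for the whole run. Equal indices have equal clamped values; no bounds are needed in this
direction. -/
theorem unifyStep_sound {e : Eqn} {E : List Eqn} {p : List Eqn × List LinCon}
    (h : unifyStep e E = some p) {ρ : ℕ → ℚ} (hL : ∀ c ∈ p.2, c.Holds ρ)
    (hp : EqnsSolvable ρ p.1) : EqnsSolvable ρ (e :: E) := by
  unfold unifyStep at h
  split at h
  case h_1 =>
    obtain ⟨θ, hθ, hm, hE⟩ := elimF_sound h hp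
    exact ⟨θ, hθ, List.forall_mem_cons.2 ⟨hm, hE⟩⟩
  case h_2 =>
    obtain ⟨θ, hθ, hm, hE⟩ := elimF_sound h hp
    exact ⟨θ, hθ, List.forall_mem_cons.2 ⟨hm.symm, hE⟩⟩
  case h_9 =>
    obtain ⟨θ, hθ, hm, hE⟩ := elimT_sound h hp
    exact ⟨θ, hθ, List.forall_mem_cons.2 ⟨hm, hE⟩⟩
  case h_10 =>
    obtain ⟨θ, hθ, hm, hE⟩ := elimT_sound h hp
    exact ⟨θ, hθ, List.forall_mem_cons.2 ⟨hm.symm, hE⟩⟩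
  all_goals
    try split at h
    all_goals first
      | cases h
        obtain ⟨θ, rfl, hE⟩ := hp
        refine ⟨θ, rfl, ?_⟩
        simp_all [Eqn.Holds, FSch.eval, TSch.eval, LinCon.Holds]
      | simp at h

/-- The same `θ` survives the step. The bounds on indices must be carried along because clamping
identifies distinct indices outside `[0,1]`. -/
theorem unifyStep_complete {e : Eqn} {E : List Eqn} {θ : Assignment}
    (he : e.Holds θ) (hE : ∀ e ∈ E, e.Holds θ) (hue : e.InUnit θ.rat)
    (hu : ∀ e ∈ E, e.InUnit θ.rat) :
    ∃ E' L, unifyStep e E = some (E', L) ∧ (∀ c ∈ L, c.Holds θ.rat) ∧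
      (∀ e ∈ E', e.Holds θ) ∧ ∀ e ∈ E', e.InUnit θ.rat := by
  have hF : ∀ {m : ℕ} {R : FSch}, θ.fm m = R.eval θ → R.InUnit θ.rat →
      ∃ E' L, elimF m R E = some (E', L) ∧ (∀ c ∈ L, c.Holds θ.rat) ∧
      (∀ e ∈ E', e.Holds θ) ∧ ∀ e ∈ E', e.InUnit θ.rat := by
    intro m R hm hR
    obtain ⟨E', h₁, h₂, h₃⟩ := elimF_complete hm hE hR hu
    exact ⟨E', [], h₁, by simp, h₂, h₃⟩
  have hT : ∀ {m : ℕ} {r : TSch}, θ.tm m = r.eval θ.tm →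
      ∃ E' L, elimT m r E = some (E', L) ∧ (∀ c ∈ L, c.Holds θ.rat) ∧
      (∀ e ∈ E', e.Holds θ) ∧ ∀ e ∈ E', e.InUnit θ.rat := by
    intro m r hm
    obtain ⟨E', h₁, h₂, h₃⟩ := elimT_complete hm hE hu
    exact ⟨E', [], h₁, by simp, h₂, h₃⟩
  unfold unifyStep
  split
  case h_1 => exact hF he hue.2
  case h_2 => exact hF (Eq.symm he) hue.1
  case h_7 e A f B =>
    simp only [Eqn.Holds, FSch.eval, Formula.prob.injEq] at he
    -- Clamping is injective on `[0,1]`: equality of the clamped indices is the recorded linear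
    -- equation.
    have hc := congrArg Subtype.val he.1
    rw [Rat01.coe_clamp hue.1.1.1 hue.1.1.2, Rat01.coe_clamp hue.2.1.1 hue.2.1.2] at hc
    refine ⟨_, _, rfl, by simpa [LinCon.Holds] using hc, ?_, ?_⟩
    · exact List.forall_mem_cons.2 ⟨he.2, hE⟩
    · exact List.forall_mem_cons.2 ⟨⟨hue.1.2, hue.2.2⟩, hu⟩
  -- Fall-through case: the outer constructors clash, so the two values cannot agree; pairs with the
  -- same constructor were caught by earlier patterns.
  case h_8 =>
    rename_i A B h₁ h₂ h₃ h₄ h₅ h₆ h₇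
    exfalso
    clear hF hT hE hu hue
    simp only [Eqn.Holds] at he
    cases A <;> cases B <;> first
      | exact h₅ _ _ _ _ rfl rfl
      | exact h₆ _ _ _ _ rfl rfl
      | exact h₇ _ _ _ _ rfl rfl
      | simp_all [FSch.eval]
  case h_9 => exact hT he
  case h_10 => exact hT (Eq.symm he)
  case h_15 =>
    rename_i s t h₁ h₂ h₃ h₄ h₅ h₆
    exfalso
    clear hF hT hE hu hue
    simp only [Eqn.Holds] at he
    cases s <;> cases t <;> first
      | exact h₅ _ _ _ _ rfl rfl
      | simp_all [TSch.eval]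
  all_goals
    clear hF hT
    simp_all [Eqn.Holds, Eqn.InUnit, FSch.eval, FSch.InUnit, TSch.eval]

theorem unify_sound (E : List Eqn) : ∀ {L : List LinCon}, unify E = some L → ∀ {ρ : ℕ → ℚ},
    (∀ c ∈ L, c.Holds ρ) → EqnsSolvable ρ E := by
  induction E using unify.induct with
  | case1 => exact fun _ ρ _ => ⟨⟨fun _ => .atom 0, fun _ => .var 0, ρ⟩, rfl, by simp⟩
  | case2 e E h =>
    intro L hL
    rw [unify] at hL
    split at hL <;> simp_all
  | case3 e E E' L' h ih =>
    intro L hL ρ hρ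
    rw [unify] at hL
    split at hL
    · simp at hL
    · rename_i h'
      rw [h] at h'
      cases h'
      obtain ⟨L'', h₁, rfl⟩ := Option.map_eq_some_iff.1 hL
      rw [List.forall_mem_append] at hρ
      exact unifyStep_sound h hρ.1 (ih h₁ hρ.2)

theorem unify_complete {θ : Assignment} (E : List Eqn) : (∀ e ∈ E, e.Holds θ) →
    (∀ e ∈ E, e.InUnit θ.rat) → ∃ L, unify E = some L ∧ ∀ c ∈ L, c.Holds θ.rat := by
  induction E using unify.induct with
  | case1 => exact fun _ _ => ⟨[], by simp [unify]⟩
  | case2 e E h =>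
    intro hE hu
    obtain ⟨E', L, h', -⟩ := unifyStep_complete (hE e (by simp))
      (fun e he => hE e (List.mem_cons_of_mem _ he)) (hu e (by simp))
      (fun e he => hu e (List.mem_cons_of_mem _ he))
    simp [h] at h'
  | case3 e E E' L' h ih =>
    intro hE hu
    obtain ⟨E'', L, h', hL, h₁, h₂⟩ := unifyStep_complete (hE e (by simp))
      (fun e he => hE e (List.mem_cons_of_mem _ he)) (hu e (by simp))
      (fun e he => hu e (List.mem_cons_of_mem _ he))
    rw [h] at h'
    cases h'
    obtain ⟨L'', h₃, h₄⟩ := ih h₁ h₂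
    refine ⟨L' ++ L'', ?_, List.forall_mem_append.2 ⟨hL, h₄⟩⟩
    rw [unify]
    split <;> simp_all

/-! ## Candidates and evidence -/

/-- The candidate stands for the formula `A`. -/
def Cand.Denotes (X : Cand) (A : Formula) : Prop :=
  ∃ θ : Assignment, X.head.eval θ = A ∧ (∀ e ∈ X.eqs, e.Holds θ) ∧ ∀ c ∈ X.lin, c.Holds θ.rat

/-- The linear system of the candidate forces all its indices into `[0,1]`. -/
def Cand.Bounded (X : Cand) : Prop :=
  ∀ ρ : ℕ → ℚ, (∀ c ∈ X.lin, c.Holds ρ) → X.head.InUnit ρ ∧ ∀ e ∈ X.eqs, e.InUnit ρ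

/-- Soundness and completeness of unification combined. Boundedness is used only from right to left.
-/
theorem Cand.Bounded.matches_iff {X : Cand} (hX : X.Bounded) (A : Formula) :
    X.Matches A ↔ X.Denotes A := by
  constructor
  · rintro ⟨L, hL, ρ, hρ⟩
    rw [List.forall_mem_append] at hρ
    obtain ⟨θ, rfl, hθ⟩ := unify_sound _ hL hρ.1
    rw [List.forall_mem_cons] at hθ
    exact ⟨θ, hθ.1.trans (FSch.eval_ofFormula θ A), hθ.2, hρ.2⟩
  · rintro ⟨θ, hA, hE, hL⟩
    obtain ⟨h₁, h₂⟩ := hX θ.rat hL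
    obtain ⟨L, hu, hL'⟩ := unify_complete (θ := θ) (.fm X.head (FSch.ofFormula A) :: X.eqs)
      (List.forall_mem_cons.2 ⟨hA.trans (FSch.eval_ofFormula θ A).symm, hE⟩)
      (List.forall_mem_cons.2 ⟨⟨h₁, FSch.inUnit_ofFormula _ A⟩, h₂⟩)
    exact ⟨L, hu, θ.rat, List.forall_mem_append.2 ⟨hL', hL⟩⟩

/-! ### Renaming -/

def Assignment.comap (k : ℕ → ℕ) (θ : Assignment) : Assignment :=
  ⟨θ.fm ∘ k, θ.tm ∘ k, θ.rat ∘ k⟩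

theorem Lin.eval_rename (k : ℕ → ℕ) (ρ : ℕ → ℚ) (e : Lin) :
    (e.rename k).eval ρ = e.eval (ρ ∘ k) := by
  induction e <;> simp_all [Lin.rename, Lin.eval]

theorem LinCon.holds_rename (k : ℕ → ℕ) (ρ : ℕ → ℚ) (c : LinCon) :
    (c.rename k).Holds ρ ↔ c.Holds (ρ ∘ k) := by
  cases c <;> simp [LinCon.rename, LinCon.Holds, Lin.eval_rename]

theorem TSch.eval_rename (k : ℕ → ℕ) (g : ℕ → Tm) (t : TSch) :
    (t.rename k).eval g = t.eval (g ∘ k) := by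
  induction t <;> simp_all [TSch.rename, TSch.eval]

theorem FSch.eval_rename (k : ℕ → ℕ) (θ : Assignment) (A : FSch) :
    (A.rename k).eval θ = A.eval (θ.comap k) := by
  induction A <;>
    simp_all [FSch.rename, FSch.eval, TSch.eval_rename, Lin.eval_rename, Assignment.comap]

theorem FSch.inUnit_rename (k : ℕ → ℕ) (ρ : ℕ → ℚ) (A : FSch) :
    (A.rename k).InUnit ρ ↔ A.InUnit (ρ ∘ k) := by
  induction A <;> simp_all [FSch.rename, FSch.InUnit, Lin.eval_rename]

theorem Eqn.holds_rename (k : ℕ → ℕ) (θ : Assignment) (e : Eqn) :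
    (e.rename k).Holds θ ↔ e.Holds (θ.comap k) := by
  cases e <;> simp [Eqn.rename, Eqn.Holds, FSch.eval_rename, TSch.eval_rename, Assignment.comap]

theorem Eqn.inUnit_rename (k : ℕ → ℕ) (ρ : ℕ → ℚ) (e : Eqn) :
    (e.rename k).InUnit ρ ↔ e.InUnit (ρ ∘ k) := by
  cases e <;> simp [Eqn.rename, Eqn.InUnit, FSch.inUnit_rename]

/-! ### Modus ponens -/

/-- The function with value `a` at multiples of `3` whose values at `3 * n + 1` and `3 * n + 2`
are `f n` and `g n`. -/
def merge {α : Type} (a : α) (f g : ℕ → α) (n : ℕ) : α :=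
  if n % 3 = 1 then f (n / 3) else if n % 3 = 2 then g (n / 3) else a

theorem merge_left {α : Type} (a : α) (f g : ℕ → α) :
    (merge a f g ∘ fun n => 3 * n + 1) = f := by
  funext n
  have h₁ : (3 * n + 1) % 3 = 1 := by omega
  have h₂ : (3 * n + 1) / 3 = n := by omega
  simp [merge, h₁, h₂]

theorem merge_right {α : Type} (a : α) (f g : ℕ → α) :
    (merge a f g ∘ fun n => 3 * n + 2) = g := by
  funext n
  have h₁ : (3 * n + 2) % 3 = 2 := by omega
  have h₂ : (3 * n + 2) / 3 = n := by omega
  simp [merge, h₁, h₂]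

/-- Renaming moves the two sets of variables to the residue classes 1 and 2 modulo 3, so independent
solutions for `X` and `Y` can be glued together. -/
theorem Cand.denotes_mp_iff (X Y : Cand) (B : Formula) :
    (X.mp Y).Denotes B ↔ ∃ A, X.Denotes (.imp A B) ∧ Y.Denotes A := by
  constructor
  · rintro ⟨θ, h₁, h₂, h₃⟩
    simp only [Cand.mp, Cand.rename, List.forall_mem_cons, List.forall_mem_append,
      List.forall_mem_map, Eqn.holds_rename, LinCon.holds_rename] at h₁ h₂ h₃
    obtain ⟨h₀, h₂, h₂'⟩ := h₂
    simp only [Eqn.Holds, FSch.imp, FSch.eval, FSch.eval_rename] at h₀ h₁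
    exact ⟨_, ⟨θ.comap _, by rw [h₀, h₁]; rfl, h₂, h₃.1⟩, θ.comap _, rfl, h₂', h₃.2⟩
  · rintro ⟨A, ⟨θ, h₁, h₂, h₃⟩, θ', h₁', h₂', h₃'⟩
    -- The fresh formula variable `0` receives the conclusion `B`. The default term and the default
    -- rational are never read.
    let η : Assignment :=
      ⟨merge B θ.fm θ'.fm, merge (.var 0) θ.tm θ'.tm, merge 0 θ.rat θ'.rat⟩
    have e₁ : η.comap (fun n => 3 * n + 1) = θ := by
      simp [η, Assignment.comap, merge_left]
    have e₂ : η.comap (fun n => 3 * n + 2) = θ' := by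
      simp [η, Assignment.comap, merge_right]
    have r₁ : η.rat ∘ (fun n => 3 * n + 1) = θ.rat := congrArg Assignment.rat e₁
    have r₂ : η.rat ∘ (fun n => 3 * n + 2) = θ'.rat := congrArg Assignment.rat e₂
    refine ⟨η, rfl, ?_, ?_⟩
    · simp only [Cand.mp, Cand.rename, List.forall_mem_cons, List.forall_mem_append,
        List.forall_mem_map, Eqn.holds_rename, e₁, e₂]
      refine ⟨?_, h₂, h₂'⟩
      simp only [Eqn.Holds, FSch.imp, FSch.eval, FSch.eval_rename, e₁, e₂, h₁, h₁']
      rfl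
    · simp only [Cand.mp, Cand.rename, List.forall_mem_append,
        List.forall_mem_map, LinCon.holds_rename, r₁, r₂]
      exact ⟨h₃, h₃'⟩

theorem Cand.Bounded.mp {X Y : Cand} (hX : X.Bounded) (hY : Y.Bounded) : (X.mp Y).Bounded := by
  intro ρ h
  simp only [Cand.mp, Cand.rename, List.forall_mem_append, List.forall_mem_map,
    LinCon.holds_rename] at h
  obtain ⟨h₁, h₂⟩ := hX _ h.1
  obtain ⟨h₃, h₄⟩ := hY _ h.2
  simp only [Cand.mp, Cand.rename, List.forall_mem_cons, List.forall_mem_append,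
    List.forall_mem_map, Eqn.inUnit_rename]
  refine ⟨trivial, ?_, h₂, h₄⟩
  simp only [Eqn.InUnit, FSch.imp, FSch.InUnit, FSch.inUnit_rename]
  exact ⟨h₁, h₃, trivial⟩

/-! ### Axioms -/

theorem Rat01.clamp_zero : Rat01.clamp 0 = 0 := Rat01.clamp_coe 0

theorem Rat01.clamp_of_one_le {q : ℚ} (h : 1 ≤ q) : Rat01.clamp q = 1 :=
  Subtype.ext (by simp [Rat01.clamp, h])

theorem Rat01.clamp_one_sub {q : ℚ} (h₀ : 0 ≤ q) (h₁ : q ≤ 1) :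
    Rat01.clamp (1 - q) = (Rat01.clamp q).compl :=
  Subtype.ext (by
    rw [Rat01.coe_clamp (by linarith) (by linarith)]
    exact congrArg (1 - ·) (Rat01.coe_clamp h₀ h₁).symm)

theorem Rat01.clamp_add (r s : Rat01) : Rat01.clamp (r.1 + s.1) = r.truncAdd s :=
  Subtype.ext (max_eq_right (le_min zero_le_one (add_nonneg r.2.1 s.2.1)))

theorem Rat01.truncAdd_eq_addOf (r s : Rat01) (h : r.1 + s.1 ≤ 1) :
    r.truncAdd s = r.addOf s h :=
  Subtype.ext (min_eq_right h)

theorem LinCon.holds_le_iff (ρ : ℕ → ℚ) (e f : Lin) :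
    (LinCon.le e f).Holds ρ ↔ e.eval ρ ≤ f.eval ρ := Iff.rfl

theorem LinCon.holds_lt_iff (ρ : ℕ → ℚ) (e f : Lin) :
    (LinCon.lt e f).Holds ρ ↔ e.eval ρ < f.eval ρ := Iff.rfl

theorem Lin.forall_mem_inUnit (ρ : ℕ → ℚ) (e : Lin) :
    (∀ c ∈ e.inUnit, c.Holds ρ) ↔ 0 ≤ e.eval ρ ∧ e.eval ρ ≤ 1 := by
  simp [Lin.inUnit, LinCon.Holds, Lin.eval]

theorem FSch.eval_ofPropSchema (θ : Assignment) (X : PropSchema) :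
    (FSch.ofPropSchema X).eval θ = X.inst θ.fm := by
  induction X <;> simp_all [FSch.ofPropSchema, FSch.eval, PropSchema.inst]

theorem FSch.inUnit_ofPropSchema (ρ : ℕ → ℚ) (X : PropSchema) :
    (FSch.ofPropSchema X).InUnit ρ := by
  induction X <;> simp_all [FSch.ofPropSchema, FSch.InUnit]

/-- This is what the side conditions are for: `1 - p` stays in `[0,1]` with `p`, a sum is bounded by
its own inequality, and the truncated case has the constant index `1`. -/
theorem bounded_of_mem_axiomCands {Γ : List PropSchema} {X : Cand} (hX : X ∈ axiomCands Γ) :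
    X.Bounded := by
  intro ρ h
  simp only [axiomCands, List.mem_append, List.mem_map, List.mem_cons, List.not_mem_nil,
    or_false] at hX
  rcases hX with ⟨X, -, rfl⟩ | rfl | rfl | rfl | rfl | rfl | rfl | rfl
  · exact ⟨FSch.inUnit_ofPropSchema ρ X, by simp⟩
  all_goals
    simp only [List.forall_mem_append, Lin.forall_mem_inUnit, List.forall_mem_cons,
      LinCon.holds_le_iff, LinCon.holds_lt_iff, Lin.eval] at h
    simp only [FSch.InUnit, FSch.imp, FSch.disj, FSch.probLe, FSch.probLt, Lin.eval,
      List.not_mem_nil, false_imp_iff, implies_true, and_true] <;>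
    grind

/-- The side conditions make clamping harmless on the values involved, so each schema evaluates to
its axiom; both halves of the split schema give instances of `dis`. -/
theorem isAxiom_of_denotes {Γ : List PropSchema} {X : Cand} (hX : X ∈ axiomCands Γ)
    {A : Formula} (hA : X.Denotes A) : IsAxiom Γ A := by
  obtain ⟨θ, rfl, -, h⟩ := hA
  simp only [axiomCands, List.mem_append, List.mem_map, List.mem_cons, List.not_mem_nil,
    or_false] at hX
  rcases hX with ⟨X, hX, rfl⟩ | rfl | rfl | rfl | rfl | rfl | rfl | rfl
  · rw [FSch.eval_ofPropSchema]
    exact .prop X hX θ.fm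
  all_goals
    simp only [List.forall_mem_append, Lin.forall_mem_inUnit, List.forall_mem_cons,
      LinCon.holds_le_iff, LinCon.holds_lt_iff, Lin.eval] at h
    simp only [FSch.eval, FSch.imp, FSch.disj, FSch.probLe, FSch.probLt, Lin.eval]
  · rw [Rat01.clamp_zero]
    exact .pi _
  · obtain ⟨⟨h₁, h₂⟩, h, -⟩ := h
    rw [Rat01.clamp_one_sub h₁.1 h₁.2]
    refine .we _ _ ?_ _
    rwa [← Subtype.coe_lt_coe, Rat01.coe_clamp h₁.1 h₁.2, Rat01.coe_clamp h₂.1 h₂.2]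
  · rw [Rat01.clamp_one_sub h.1 h.2]
    exact .le _ _
  · obtain ⟨⟨h₁, h₂⟩, h, -⟩ := h
    have := IsAxiom.dis (Γ := Γ) (Rat01.clamp (θ.rat 0)) (Rat01.clamp (θ.rat 1)) (θ.fm 0) (θ.fm 1)
    rw [← Rat01.clamp_add, Rat01.coe_clamp h₁.1 h₁.2, Rat01.coe_clamp h₂.1 h₂.2] at this
    rwa [Rat01.clamp_of_one_le le_rfl]
  · obtain ⟨⟨h₁, h₂⟩, h, -⟩ := h
    have := IsAxiom.dis (Γ := Γ) (Rat01.clamp (θ.rat 0)) (Rat01.clamp (θ.rat 1)) (θ.fm 0) (θ.fm 1)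
    rw [← Rat01.clamp_add, Rat01.coe_clamp h₁.1 h₁.2, Rat01.coe_clamp h₂.1 h₂.2,
      Rat01.clamp_of_one_le h] at this
    rwa [Rat01.clamp_of_one_le le_rfl]
  · obtain ⟨⟨h₁, h₂⟩, h, -⟩ := h
    have h' : (Rat01.clamp (θ.rat 0)).1 + (Rat01.clamp (θ.rat 1)).1 ≤ 1 := by
      rwa [Rat01.coe_clamp h₁.1 h₁.2, Rat01.coe_clamp h₂.1 h₂.2]
    have := IsAxiom.un (Γ := Γ) _ _ h' (θ.fm 0) (θ.fm 1)
    rw [← Rat01.truncAdd_eq_addOf, ← Rat01.clamp_add, Rat01.coe_clamp h₁.1 h₁.2,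
      Rat01.coe_clamp h₂.1 h₂.2] at this
    rwa [Rat01.clamp_one_sub h₁.1 h₁.2]
  · exact .j _ _ _ _

theorem exists_denotes_of_isAxiom {Γ : List PropSchema} {A : Formula} (hA : IsAxiom Γ A) :
    ∃ X ∈ axiomCands Γ, X.Denotes A := by
  have pair : ∀ {α : Type} (a b : α), ∃ f : ℕ → α, f 0 = a ∧ f 1 = b :=
    fun a b => ⟨fun n => if n = 0 then a else b, by simp⟩
  -- Outside `Γ` the schemata use only the variables `0` and `1` of each sort.
  have key : ∀ (A B : Formula) (s t : Tm) (r q : Rat01), ∃ θ : Assignment,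
      θ.fm 0 = A ∧ θ.fm 1 = B ∧ θ.tm 0 = s ∧ θ.tm 1 = t ∧ θ.rat 0 = r.1 ∧ θ.rat 1 = q.1 := by
    intro A B s t r q
    obtain ⟨f, hf, hf'⟩ := pair A B
    obtain ⟨g, hg, hg'⟩ := pair s t
    obtain ⟨ρ, hρ, hρ'⟩ := pair r.1 q.1
    exact ⟨⟨f, g, ρ⟩, hf, hf', hg, hg', hρ, hρ'⟩
  have hc : ∀ r : Rat01, Rat01.clamp (1 - r.1) = r.compl := fun r => Rat01.clamp_coe r.compl
  have h1 : Rat01.clamp 1 = 1 := Rat01.clamp_of_one_le le_rfl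
  have hu : ∀ r : Rat01, 0 ≤ r.1 ∧ r.1 ≤ 1 := fun r => r.2
  cases hA with
  | prop X hX σ =>
    exact ⟨⟨FSch.ofPropSchema X, [], []⟩,
      List.mem_append_left _ (List.mem_map.2 ⟨X, hX, rfl⟩),
      ⟨σ, fun _ => .var 0, fun _ => 0⟩, FSch.eval_ofPropSchema _ X, by simp, by simp⟩
  | pi A =>
    obtain ⟨θ, h⟩ := key A A (.var 0) (.var 0) 0 0
    refine ⟨_, List.mem_append_right _ (List.mem_cons_self ..), θ, ?_, ?_, ?_⟩
    · simp [FSch.eval, Lin.eval, Rat01.clamp_zero, h]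
    all_goals simp
  | we r s hrs A =>
    obtain ⟨θ, h⟩ := key A A (.var 0) (.var 0) r s
    refine ⟨_, List.mem_append_right _ (List.mem_of_getElem? (i := 1) rfl), θ, ?_, ?_, ?_⟩
    · simp [FSch.eval, Lin.eval, FSch.imp, FSch.probLe, FSch.probLt, Formula.imp,
        Formula.probLe, Formula.probLt, Rat01.clamp_coe, hc, h]
    · simp
    · simp only [List.forall_mem_append, Lin.forall_mem_inUnit, List.forall_mem_cons,
        LinCon.holds_lt_iff, Lin.eval, h, hu, true_and]
      exact ⟨hrs, by simp⟩
  | le s A =>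
    obtain ⟨θ, h⟩ := key A A (.var 0) (.var 0) s s
    refine ⟨_, List.mem_append_right _ (List.mem_of_getElem? (i := 2) rfl), θ, ?_, ?_, ?_⟩
    · simp [FSch.eval, Lin.eval, FSch.imp, FSch.probLe, FSch.probLt, Formula.imp,
        Formula.probLe, Formula.probLt, Rat01.clamp_coe, hc, h]
    · simp
    · simp only [Lin.forall_mem_inUnit, Lin.eval, h, hu, true_and]
  | dis r s A B =>
    obtain ⟨θ, h⟩ := key A B (.var 0) (.var 0) r s
    -- The sum decides which half of the split schema covers the instance; when it equals `1`,
    -- either does.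
    rcases le_total (r.1 + s.1) 1 with hrs | hrs
    · refine ⟨_, List.mem_append_right _ (List.mem_of_getElem? (i := 3) rfl), θ, ?_, ?_, ?_⟩
      · simp [FSch.eval, Lin.eval, FSch.imp, FSch.disj, Formula.imp,
          Formula.disj, Rat01.clamp_coe, h1, Rat01.clamp_add, h]
      · simp
      · simp only [List.forall_mem_append, Lin.forall_mem_inUnit, List.forall_mem_cons,
          LinCon.holds_le_iff, Lin.eval, h, hu, true_and]
        exact ⟨hrs, by simp⟩
    · refine ⟨_, List.mem_append_right _ (List.mem_of_getElem? (i := 4) rfl), θ, ?_, ?_, ?_⟩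
      · simp [FSch.eval, Lin.eval, FSch.imp, FSch.disj, Formula.imp,
          Formula.disj, Rat01.clamp_coe, h1, ← Rat01.clamp_add, Rat01.clamp_of_one_le hrs, h]
      · simp
      · simp only [List.forall_mem_append, Lin.forall_mem_inUnit, List.forall_mem_cons,
          LinCon.holds_le_iff, Lin.eval, h, hu, true_and]
        exact ⟨hrs, by simp⟩
  | un r s hrs A B =>
    obtain ⟨θ, h⟩ := key A B (.var 0) (.var 0) r s
    refine ⟨_, List.mem_append_right _ (List.mem_of_getElem? (i := 5) rfl), θ, ?_, ?_, ?_⟩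
    · simp [FSch.eval, Lin.eval, FSch.imp, FSch.disj, FSch.probLe, FSch.probLt, Formula.imp,
        Formula.disj, Formula.probLe, Formula.probLt, Rat01.clamp_coe, Rat01.clamp_add, hc,
        Rat01.truncAdd_eq_addOf _ _ hrs, h]
    · simp
    · simp only [List.forall_mem_append, Lin.forall_mem_inUnit, List.forall_mem_cons,
        LinCon.holds_le_iff, Lin.eval, h, hu, true_and]
      exact ⟨hrs, by simp⟩
  | j s t A B =>
    obtain ⟨θ, h⟩ := key A B s t 0 0
    refine ⟨_, List.mem_append_right _ (List.mem_of_getElem? (i := 6) rfl), θ, ?_, ?_, ?_⟩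
    · simp [FSch.eval, TSch.eval, FSch.imp, Formula.imp, h]
    all_goals simp

theorem Cand.denotes_just_iff (t : Tm) (X : Cand) (B : Formula) :
    Cand.Denotes ⟨.just (TSch.ofTm t) X.head, X.eqs, X.lin⟩ B ↔
      ∃ A, X.Denotes A ∧ B = .just t A := by
  constructor
  · rintro ⟨θ, rfl, h⟩
    exact ⟨_, ⟨θ, rfl, h⟩, by simp [FSch.eval, TSch.eval_ofTm]⟩
  · rintro ⟨_, ⟨θ, rfl, h⟩, rfl⟩
    exact ⟨θ, by simp [FSch.eval, TSch.eval_ofTm], h⟩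

theorem exists_constCands {Γ : List PropSchema} {A : Formula} (hA : IsAxiom Γ A) (c n : ℕ) :
    ∃ X ∈ constCands Γ ((Tm.const c).bangs n), X.Denotes (Formula.bangTower c A n) := by
  induction n with
  | zero => exact exists_denotes_of_isAxiom hA
  | succ n ih =>
    obtain ⟨X, hX, h⟩ := ih
    exact ⟨_, List.mem_map_of_mem hX, (Cand.denotes_just_iff _ X _).2 ⟨_, h, rfl⟩⟩

/-- Only constants start a tower and each `!` adds one layer, so these candidates yield nothing
beyond what `evid_const` demands. Needed for minimality. -/
theorem exists_eq_bangTower {Γ : List PropSchema} (t : Tm) : ∀ {X : Cand} {B : Formula},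
    X ∈ constCands Γ t → X.Denotes B → ∃ (c n : ℕ) (A : Formula), IsAxiom Γ A ∧
      t = (Tm.const c).bangs n ∧ B = Formula.bangTower c A n := by
  induction t with
  | const c => exact fun hX hB => ⟨c, 0, _, isAxiom_of_denotes hX hB, rfl, rfl⟩
  | var x => intro X B hX; simp [constCands] at hX
  | app s t => intro X B hX; simp [constCands] at hX
  | bang t ih =>
    intro X B hX hB
    obtain ⟨Y, hY, rfl⟩ := List.mem_map.1 hX
    obtain ⟨C, hC, rfl⟩ := (Cand.denotes_just_iff _ Y _).1 hB
    obtain ⟨c, n, A, hA, rfl, rfl⟩ := ih hY hC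
    exact ⟨c, n + 1, A, hA, rfl, rfl⟩

theorem bounded_of_mem_constCands {Γ : List PropSchema} (t : Tm) : ∀ {X : Cand},
    X ∈ constCands Γ t → X.Bounded := by
  induction t with
  | const c => exact bounded_of_mem_axiomCands
  | var x => intro X hX; simp [constCands] at hX
  | app s t => intro X hX; simp [constCands] at hX
  | bang t ih =>
    intro X hX
    obtain ⟨Y, hY, rfl⟩ := List.mem_map.1 hX
    exact fun ρ h => ih hY ρ h

/-! ### Candidates for the terms of a branch -/

theorem Branch.mem_assumptions {b : Branch} {t : Tm} {A : Formula} :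
    A ∈ b.assumptions t ↔ (true, .just t A) ∈ b := by
  rw [Branch.assumptions, List.mem_filterMap]
  constructor
  · rintro ⟨X, hX, h⟩
    split at h
    · split at h
      · cases h; simp_all
      · simp at h
    · simp at h
  · exact fun h => ⟨_, h, by simp⟩

/-- `constCands` is empty on variables and applications, which allows one description for all terms.
-/
theorem Branch.cands_eq (Γ : List PropSchema) (b : Branch) (t : Tm) :
    b.cands Γ t = (b.assumptions t).map (fun B => ⟨FSch.ofFormula B, [], []⟩) ++
      (constCands Γ t ++ match t with
        | .app s t => (b.cands Γ s).flatMap fun X => (b.cands Γ t).map fun Y => X.mp Y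
        | _ => []) := by
  cases t <;> simp [Branch.cands, constCands]

theorem Branch.bounded_of_mem_cands {Γ : List PropSchema} {b : Branch} (t : Tm) :
    ∀ {X : Cand}, X ∈ b.cands Γ t → X.Bounded := by
  have base : ∀ {t : Tm} {X : Cand}, X ∈ (b.assumptions t).map
      (fun B => (⟨FSch.ofFormula B, [], []⟩ : Cand)) → X.Bounded := by
    intro t X hX
    obtain ⟨B, -, rfl⟩ := List.mem_map.1 hX
    exact fun ρ _ => ⟨FSch.inUnit_ofFormula ρ B, by simp⟩
  induction t with
  | app s t hs ht =>
    intro X hX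
    simp only [Branch.cands, List.mem_append, List.mem_flatMap, List.mem_map (l := b.cands Γ t)]
      at hX
    obtain hX | ⟨Y, hY, Z, hZ, rfl⟩ := hX
    · exact base hX
    · exact (hs hY).mp (ht hZ)
  | var x => exact base
  | const c | bang t =>
    intro X hX
    exact (List.mem_append.1 hX).elim base (bounded_of_mem_constCands _)

/-- The `M`-model whose evidence function is the least one that contains the formulas `s : B`
with `T s : B` on the branch. -/
def Branch.mmodel (Γ : List PropSchema) (b : Branch) (v : ℕ → Bool) : MModel Γ where
  val := v
  evid t := {A | ∃ X ∈ b.cands Γ t, X.Denotes A}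
  evid_app := by
    rintro s t A B ⟨X, hX, h⟩ ⟨Y, hY, h'⟩
    refine ⟨X.mp Y, ?_, (Cand.denotes_mp_iff X Y B).2 ⟨A, h, h'⟩⟩
    exact List.mem_append_right _ (List.mem_flatMap.2 ⟨X, hX, List.mem_map_of_mem hY⟩)
  evid_const := by
    intro c n A hA
    obtain ⟨X, hX, h⟩ := exists_constCands hA c n
    refine ⟨X, ?_, h⟩
    rw [Branch.cands_eq]
    exact List.mem_append_right _ (List.mem_append_left _ hX)

theorem Branch.mem_evid_mmodel {Γ : List PropSchema} {b : Branch} {v : ℕ → Bool} {t : Tm}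
    {A : Formula} (h : (true, .just t A) ∈ b) : A ∈ (b.mmodel Γ v).evid t := by
  refine ⟨⟨FSch.ofFormula A, [], []⟩, ?_, ⟨fun _ => A, fun _ => t, fun _ => 0⟩,
    FSch.eval_ofFormula _ A, by simp, by simp⟩
  rw [Branch.cands_eq]
  exact List.mem_append_left _ (List.mem_map.2 ⟨A, Branch.mem_assumptions.2 h, rfl⟩)

/-- Half of the meaning of the check: for bounded candidates, not matching is the same as not
denoting. -/
theorem Branch.JustCheck.notMem_evid {Γ : List PropSchema} {b : Branch} (hb : b.JustCheck Γ)
    {v : ℕ → Bool} {t : Tm} {A : Formula} (h : (false, .just t A) ∈ b) :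
    A ∉ (b.mmodel Γ v).evid t := by
  rintro ⟨X, hX, hA⟩
  exact hb t A h X hX (((Branch.bounded_of_mem_cands t hX).matches_iff A).2 hA)

/-- Minimality of the evidence function in `Branch.mmodel`: assumptions are given, towers come from
`evid_const`, and modus ponens from `evid_app`. -/
theorem MModel.mem_evid_of_denotes {Γ : List PropSchema} (N : MModel Γ) {b : Branch}
    (hN : ∀ t A, (true, .just t A) ∈ b → A ∈ N.evid t) (t : Tm) : ∀ {X : Cand} {A : Formula},
    X ∈ b.cands Γ t → X.Denotes A → A ∈ N.evid t := by
  have base : ∀ {t : Tm} {X : Cand} {A : Formula}, X ∈ (b.assumptions t).map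
      (fun B => (⟨FSch.ofFormula B, [], []⟩ : Cand)) → X.Denotes A → A ∈ N.evid t := by
    rintro t X _ hX ⟨θ, rfl, -⟩
    obtain ⟨B, hB, rfl⟩ := List.mem_map.1 hX
    rw [FSch.eval_ofFormula]
    exact hN t B (Branch.mem_assumptions.1 hB)
  have const : ∀ {t : Tm} {X : Cand} {A : Formula}, X ∈ constCands Γ t → X.Denotes A →
      A ∈ N.evid t := by
    intro t X A hX hA
    obtain ⟨c, n, B, hB, rfl, rfl⟩ := exists_eq_bangTower t hX hA
    exact N.evid_const c n B hB
  induction t with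
  | app s t hs ht =>
    intro X A hX hA
    simp only [Branch.cands, List.mem_append, List.mem_flatMap, List.mem_map (l := b.cands Γ t)]
      at hX
    obtain hX | ⟨Y, hY, Z, hZ, rfl⟩ := hX
    · exact base hX hA
    · obtain ⟨B, h₁, h₂⟩ := (Cand.denotes_mp_iff Y Z A).1 hA
      exact N.evid_app s t B A (hs hY h₁) (ht hZ h₂)
  | var x => exact base
  | const c | bang t =>
    intro X A hX hA
    exact (List.mem_append.1 hX).elim (base · hA) (const · hA)

/-- The other half: a matching candidate would, by minimality, force an `F`-justification into the
evidence of `N`. -/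
theorem MModel.justCheck {Γ : List PropSchema} (N : MModel Γ) {b : Branch}
    (hT : ∀ t A, (true, .just t A) ∈ b → A ∈ N.evid t)
    (hF : ∀ t A, (false, .just t A) ∈ b → A ∉ N.evid t) : b.JustCheck Γ :=
  fun t A h _ hX hA => hF t A h
    (N.mem_evid_of_denotes hT t hX (((Branch.bounded_of_mem_cands t hX).matches_iff A).1 hA))

/-! ## Termination -/

/-- The nesting depth of probability operators. -/
def Formula.probDepth : Formula → ℕ
  | atom _ => 0
  | neg A => A.probDepth
  | conj A B => max A.probDepth B.probDepth
  | just _ _ => 0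
  | prob _ A => A.probDepth + 1

/-- The formulas that arise from a formula by removing outer propositional connectives. -/
def Formula.parts : Formula → Set Formula
  | neg A => insert (neg A) A.parts
  | conj A B => insert (conj A B) (A.parts ∪ B.parts)
  | A => {A}

theorem Formula.finite_parts (A : Formula) : A.parts.Finite := by
  induction A with
  | neg A h => exact h.insert _
  | conj A B hA hB => exact (hA.union hB).insert _
  | _ => exact Set.finite_singleton _

theorem Formula.mem_parts_self (A : Formula) : A ∈ A.parts := by
  cases A <;> simp [Formula.parts]

theorem Formula.probDepth_le_of_mem_parts {A B : Formula} (h : B ∈ A.parts) :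
    B.probDepth ≤ A.probDepth := by
  induction A with
  | neg A hA =>
    rcases h with rfl | h
    · rfl
    · exact hA h
  | conj A C hA hC =>
    rcases h with rfl | h | h
    · rfl
    · exact (hA h).trans (le_max_left _ _)
    · exact (hC h).trans (le_max_right _ _)
  | _ => cases h; rfl

/-- Closure under removing outer propositional connectives. -/
structure PartsClosed (P : Set Formula) : Prop where
  neg : ∀ A, Formula.neg A ∈ P → A ∈ P
  conj : ∀ A B, Formula.conj A B ∈ P → A ∈ P ∧ B ∈ P

theorem Formula.partsClosed_parts (A : Formula) : PartsClosed A.parts := by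
  induction A with
  | neg A h =>
    constructor
    · rintro B (hB | hB)
      · cases hB; exact Or.inr A.mem_parts_self
      · exact Or.inr (h.neg B hB)
    · rintro B C (hB | hB)
      · cases hB
      · exact (h.conj B C hB).imp Or.inr Or.inr
  | conj A A' h h' =>
    constructor
    · rintro B (hB | hB | hB)
      · cases hB
      · exact Or.inr (Or.inl (h.neg B hB))
      · exact Or.inr (Or.inr (h'.neg B hB))
    · rintro B C (hB | hB | hB)
      · cases hB
        exact ⟨Or.inr (Or.inl A.mem_parts_self), Or.inr (Or.inr A'.mem_parts_self)⟩
      · exact (h.conj B C hB).imp (Or.inr ∘ Or.inl) (Or.inr ∘ Or.inl)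
      · exact (h'.conj B C hB).imp (Or.inr ∘ Or.inr) (Or.inr ∘ Or.inr)
  | _ => constructor <;> intros <;> simp_all [Formula.parts]

theorem probDepth_bigConj_le {l : List Formula} {d : ℕ} (h : ∀ A ∈ l, A.probDepth ≤ d) :
    (bigConj l).probDepth ≤ d := by
  induction l using bigConj.induct with
  | case1 => exact Nat.zero_le d
  | case2 A => exact h A (by simp)
  | case3 A B l ih =>
    exact max_le (h A (by simp)) (ih fun C hC => h C (List.mem_cons_of_mem _ hC))

theorem probDepth_atomOf_le {m : ℕ} {B : Fin m → Formula} {d : ℕ}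
    (h : ∀ j, (B j).probDepth ≤ d) (ε : Fin m → Bool) : (atomOf B ε).probDepth ≤ d := by
  refine probDepth_bigConj_le fun A hA => ?_
  obtain ⟨j, rfl⟩ := (List.mem_ofFn' _ _).1 hA
  dsimp only
  split
  · exact h j
  · exact h j

/-- Supplies the strict decrease in the inner induction for termination: the set of signed formulas
over `P` missing from the branch shrinks. -/
theorem PropApplicable.exists_result {b : Branch} {r : RuleApp} (h : PropApplicable b r)
    (i : r.Idx) {P : Set Formula} (hP : PartsClosed P) (hb : ∀ X ∈ b, X.2 ∈ P) :
    (∀ X ∈ r.result b i, X.2 ∈ P) ∧ (∀ X ∈ b, X ∈ r.result b i) ∧ ∃ X ∈ r.result b i, X ∉ b := by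
  cases h with
  | negT A h h' | negF A h h' =>
    have := hP.neg A (hb _ h)
    simp only [RuleApp.result]
    grind
  | conjT A B h h' =>
    have := hP.conj A B (hb _ h)
    simp only [RuleApp.result]
    grind
  | conjF A B h h₁ h₂ =>
    have := hP.conj A B (hb _ h)
    cases i <;> simp only [RuleApp.result] <;> grind

/-- Lexicographic descent: first the bound `d` on the probability depth, then the number of signed
formulas over `P` not yet on the branch. A new world restarts with the parts of a single
conjunction, of depth at most `d - 1`. -/
theorem acc_expands_of_forall_mem (d : ℕ) : ∀ {P : Set Formula}, P.Finite → PartsClosed P →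
    (∀ A ∈ P, A.probDepth ≤ d) → ∀ b : Branch, (∀ X ∈ b, X.2 ∈ P) → Acc Expands b := by
  induction d using Nat.strong_induction_on with
  | _ d ihd =>
  intro P hfin hP hd b
  have hfin' : (Set.univ ×ˢ P : Set Signed).Finite := Set.finite_univ.prod hfin
  induction hn : ((Set.univ ×ˢ P : Set Signed) \ {X | X ∈ b}).ncard using
    Nat.strong_induction_on generalizing b with
  | _ n ihn =>
  intro hb
  refine ⟨_, ?_⟩
  rintro _ ⟨r, hr, i, rfl⟩
  cases hr with
  | propositional _ hr =>
    obtain ⟨h₁, h₂, X, hX, hX'⟩ := hr.exists_result i hP hb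
    refine ihn _ ?_ _ rfl h₁
    rw [← hn]
    refine Set.ncard_lt_ncard ?_ (hfin'.subset Set.sdiff_subset)
    refine ⟨fun Y hY => ⟨hY.1, fun h => hY.2 (h₂ Y h)⟩, fun h => ?_⟩
    exact (h ⟨⟨trivial, h₁ X hX⟩, hX'⟩).2 hX
  | probabilistic m B hr =>
    obtain ⟨-, -, hm, -, hB⟩ := hr
    have hlt : ∀ j, (B j).probDepth + 1 ≤ d := by
      intro j
      obtain ⟨sgn, s, h⟩ := (hB (B j)).1 ⟨j, rfl⟩
      exact hd _ (hb _ h)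
    -- Since `0 < m`, a probabilistic formula is on the branch; hence `d` is positive and `d - 1` is
    -- really smaller.
    have hd' : 1 ≤ d := le_trans (Nat.le_add_left _ _) (hlt ⟨0, hm⟩)
    refine ihd (d - 1) (by omega) (atomOf B i).finite_parts (atomOf B i).partsClosed_parts
      (fun A hA => (Formula.probDepth_le_of_mem_parts hA).trans
        (probDepth_atomOf_le (fun j => Nat.le_sub_of_add_le (hlt j)) i)) _ ?_
    intro X hX
    cases List.mem_singleton.1 hX
    exact Formula.mem_parts_self _

theorem acc_expands_rootBranch (A : Formula) : Acc Expands (rootBranch A) := by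
  refine acc_expands_of_forall_mem A.probDepth A.finite_parts A.partsClosed_parts
    (fun _ => Formula.probDepth_le_of_mem_parts) _ fun X hX => ?_
  cases List.mem_singleton.1 hX
  exact A.mem_parts_self

/-- Recursion along accessibility: apply any applicable rule, and stop at complete branches. -/
theorem exists_isTableau {b : Branch} (h : Acc Expands b) : ∃ T, IsTableau b T := by
  induction h with
  | intro b _ ih =>
    by_cases hb : b.Complete
    · exact ⟨.leaf, .leaf b (Or.inr hb)⟩
    · simp only [Branch.Complete, not_forall, not_not] at hb
      obtain ⟨r, hr⟩ := hb
      choose T hT using fun i => ih (r.result b i) ⟨r, hr, i, rfl⟩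
      exact ⟨.node r T, .node b r T hr hT⟩

/-! ## Probability spaces -/

theorem ProbSpace.empty_mem {U : Type u} (S : ProbSpace U) : ∅ ∈ S.H := by
  simpa using S.diff_mem S.W S.whole_mem

theorem ProbSpace.μ_empty {U : Type u} (S : ProbSpace U) : (S.μ ⟨∅, S.empty_mem⟩ : ℝ) = 0 := by
  have h := S.μ_union ⟨∅, S.empty_mem⟩ ⟨∅, S.empty_mem⟩ (Set.disjoint_empty _)
  have h' : (⟨∅ ∪ ∅, S.union_mem ∅ S.empty_mem ∅ S.empty_mem⟩ : S.H) = ⟨∅, S.empty_mem⟩ :=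
    Subtype.ext (Set.union_empty ∅)
  simp only [h'] at h
  linarith

theorem ProbSpace.exists_μ_biUnion {U : Type u} (S : ProbSpace U) {ι : Type} {X : ι → Set U}
    (hX : ∀ i, X i ∈ S.H) (hd : Pairwise fun i j => Disjoint (X i) (X j)) (s : Finset ι) :
    ∃ h : (⋃ i ∈ s, X i) ∈ S.H, (S.μ ⟨_, h⟩ : ℝ) = ∑ i ∈ s, (S.μ ⟨X i, hX i⟩ : ℝ) := by
  classical
  induction s using Finset.induction_on with
  | empty =>
    have h : (⋃ i ∈ (∅ : Finset ι), X i) = ∅ := by simp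
    refine ⟨h ▸ S.empty_mem, ?_⟩
    simp only [h, Finset.sum_empty]
    exact S.μ_empty
  | insert i s hi ih =>
    obtain ⟨h, hs⟩ := ih
    have e : (⋃ j ∈ insert i s, X j) = X i ∪ ⋃ j ∈ s, X j := Finset.set_biUnion_insert i s X
    refine ⟨e ▸ S.union_mem _ (hX i) _ h, ?_⟩
    simp only [e]
    rw [Finset.sum_insert hi, ← hs]
    refine S.μ_union ⟨X i, hX i⟩ ⟨_, h⟩ ?_
    simp only [Set.disjoint_iUnion_right]
    exact fun j hj => hd fun e => hi (e ▸ hj)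

/-- The image of a probability space under a map of states. -/
def ProbSpace.map {U : Type*} {V : Type*} (S : ProbSpace U) (f : U → V) : ProbSpace V where
  W := f '' S.W
  nonempty := S.nonempty.image f
  H := {X | X ⊆ f '' S.W ∧ S.W ∩ f ⁻¹' X ∈ S.H}
  subset_of_mem _ hX := hX.1
  whole_mem := by
    refine ⟨le_rfl, ?_⟩
    rw [Set.inter_eq_left.2 (Set.subset_preimage_image f S.W)]
    exact S.whole_mem
  union_mem X hX Y hY := by
    refine ⟨Set.union_subset hX.1 hY.1, ?_⟩
    rw [Set.preimage_union, Set.inter_union_distrib_left]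
    exact S.union_mem _ hX.2 _ hY.2
  diff_mem X hX := by
    refine ⟨Set.sdiff_subset, ?_⟩
    have : S.W ∩ f ⁻¹' (f '' S.W \ X) = S.W \ (S.W ∩ f ⁻¹' X) := by
      ext v
      simp only [Set.mem_inter_iff, Set.mem_preimage, Set.mem_sdiff]
      exact ⟨fun h => ⟨h.1, fun h' => h.2.2 h'.2⟩,
        fun h => ⟨h.1, Set.mem_image_of_mem f h.1, fun h' => h.2 ⟨h.1, h'⟩⟩⟩
    rw [this]
    exact S.diff_mem _ hX.2
  μ X := S.μ ⟨_, X.2.2⟩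
  μ_whole := by
    have h : S.W ∩ f ⁻¹' (f '' S.W) = S.W := Set.inter_eq_left.2 (Set.subset_preimage_image f S.W)
    simp only [h]
    exact S.μ_whole
  μ_union X Y hXY := by
    have h : S.W ∩ f ⁻¹' (X.1 ∪ Y.1) = (S.W ∩ f ⁻¹' X.1) ∪ (S.W ∩ f ⁻¹' Y.1) := by
      rw [Set.preimage_union, Set.inter_union_distrib_left]
    simp only [h]
    exact S.μ_union ⟨_, X.2.2⟩ ⟨_, Y.2.2⟩
      ((hXY.preimage f).mono Set.inter_subset_right Set.inter_subset_right)

open Classical in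
/-- The probability space on a finite type given by the probabilities of its elements. -/
noncomputable def ProbSpace.ofWeights {ι : Type} [Fintype ι] (x : ι → ℝ) (h₀ : ∀ i, 0 ≤ x i)
    (h₁ : ∑ i, x i = 1) : ProbSpace ι where
  W := Set.univ
  nonempty := by
    -- Over an empty type the weights would sum to `0`, not `1`.
    by_contra h
    rw [Set.not_nonempty_iff_eq_empty, Set.univ_eq_empty_iff] at h
    simp at h₁
  H := Set.univ
  subset_of_mem X _ := Set.subset_univ X
  whole_mem := trivial
  union_mem _ _ _ _ := trivial
  diff_mem _ _ := trivial
  μ X := ⟨∑ i with i ∈ X.1, x i, Finset.sum_nonneg fun i _ => h₀ i,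
    h₁ ▸ Finset.sum_le_sum_of_subset_of_nonneg (Finset.filter_subset _ _) fun i _ _ => h₀ i⟩
  μ_whole := by simpa using h₁
  μ_union X Y hXY := by
    rw [← Finset.sum_union]
    · refine Finset.sum_congr ?_ fun _ _ => rfl
      ext i
      simp
    · rw [Finset.disjoint_filter]
      exact fun i _ hX hY => Set.disjoint_left.1 hXY hX hY

open Classical in
theorem ProbSpace.μ_map_ofWeights {ι : Type} [Fintype ι] {x : ι → ℝ} {h₀ : ∀ i, 0 ≤ x i}
    {h₁ : ∑ i, x i = 1} {V : Type u} (f : ι → V) {X : Set V}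
    (h : X ∈ ((ProbSpace.ofWeights x h₀ h₁).map f).H) :
    (((ProbSpace.ofWeights x h₀ h₁).map f).μ ⟨X, h⟩ : ℝ) = ∑ i with f i ∈ X, x i := by
  refine Finset.sum_congr ?_ fun _ _ => rfl
  ext i
  simp [ProbSpace.ofWeights]

/-! ## Models -/

/-- The disjoint union of a family of models together with a new world. -/
def Model.graft {Γ : List PropSchema} {ι : Type} {U : ι → Type u} (M : ∀ i, Model Γ (U i))
    (S : ProbSpace (Option (Σ i, U i))) (N : MModel Γ) : Model Γ (Option (Σ i, U i)) where
  space
    | none => S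
    | some ⟨i, w⟩ => ((M i).space w).map fun v => some ⟨i, v⟩
  mmodel
    | none => N
    | some ⟨i, w⟩ => (M i).mmodel w

/-- The space at an old world is a push-forward into its own component, so agreement on `A` there
carries over to truth sets. Used both for satisfaction and for measurability. -/
theorem Model.truthSet_graft {Γ : List PropSchema} {ι : Type} {U : ι → Type u}
    {M : ∀ i, Model Γ (U i)} {S : ProbSpace (Option (Σ i, U i))} {N : MModel Γ} {i : ι}
    {A : Formula} (h : ∀ w, (Model.graft M S N).Sat A (some ⟨i, w⟩) ↔ (M i).Sat A w) (w : U i) :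
    (Model.graft M S N).truthSet A (some ⟨i, w⟩) ⊆ (fun v => some ⟨i, v⟩) '' ((M i).space w).W ∧
    ((M i).space w).W ∩ (fun v => some ⟨i, v⟩) ⁻¹'
      (Model.graft M S N).truthSet A (some ⟨i, w⟩) = (M i).truthSet A w := by
  constructor
  · exact fun v hv => hv.1
  · ext v
    refine and_congr_right fun hv => ?_
    rw [← h]
    exact ⟨fun h => h.2, fun h => ⟨Set.mem_image_of_mem _ hv, h⟩⟩

theorem Model.sat_graft {Γ : List PropSchema} {ι : Type} {U : ι → Type u}
    (M : ∀ i, Model Γ (U i)) (S : ProbSpace (Option (Σ i, U i))) (N : MModel Γ) {i : ι}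
    (A : Formula) : ∀ w, (Model.graft M S N).Sat A (some ⟨i, w⟩) ↔ (M i).Sat A w := by
  induction A with
  | atom p => exact fun w => Iff.rfl
  | neg A h => exact fun w => not_congr (h w)
  | conj A B hA hB => exact fun w => and_congr (hA w) (hB w)
  | just t A h => exact fun w => Iff.rfl
  | prob s A h =>
    intro w
    obtain ⟨h₁, h₂⟩ := Model.truthSet_graft h w
    -- Making the preimage a variable `Y` lets the set and the membership proof inside `μ` change
    -- together.
    have key : ∀ Y, ((M i).space w).W ∩ (fun v => some ⟨i, v⟩) ⁻¹'
        (Model.graft M S N).truthSet A (some ⟨i, w⟩) = Y →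
        ((Model.graft M S N).Sat (.prob s A) (some ⟨i, w⟩) ↔
          ∃ h : Y ∈ ((M i).space w).H, ((s.1 : ℚ) : ℝ) ≤ (((M i).space w).μ ⟨_, h⟩ : ℝ)) := by
      rintro _ rfl
      exact ⟨fun ⟨h, hs⟩ => ⟨h.2, hs⟩, fun ⟨h, hs⟩ => ⟨⟨h₁, h⟩, hs⟩⟩
    exact key _ h₂

theorem Model.Measurable.graft {Γ : List PropSchema} {ι : Type} {U : ι → Type u}
    {M : ∀ i, Model Γ (U i)} (hM : ∀ i, (M i).Measurable) {S : ProbSpace (Option (Σ i, U i))}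
    (hS : ∀ X ⊆ S.W, X ∈ S.H) (N : MModel Γ) : (Model.graft M S N).Measurable := by
  rintro (_ | ⟨i, w⟩) A
  · exact hS _ fun v hv => hv.1
  · obtain ⟨h₁, h₂⟩ := Model.truthSet_graft (Model.sat_graft M S N A) w
    exact ⟨h₁, h₂ ▸ hM i w A⟩

/-! ### Truth of conjunctions and of signed branches at a world -/

theorem Model.sat_bigConj {Γ : List PropSchema} {U : Type u} (M : Model Γ U) (w : U)
    (l : List Formula) : M.Sat (bigConj l) w ↔ ∀ A ∈ l, M.Sat A w := by
  induction l using bigConj.induct with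
  | case1 => simp [bigConj, Model.Sat]
  | case2 A => simp [bigConj]
  | case3 A B l ih => rw [bigConj, Model.Sat, ih, List.forall_mem_cons (l := B :: l)]

theorem Model.sat_atomOf {Γ : List PropSchema} {U : Type u} (M : Model Γ U) (w : U) {m : ℕ}
    (B : Fin m → Formula) (ε : Fin m → Bool) :
    M.Sat (atomOf B ε) w ↔ ∀ j, M.Sat (B j) w ↔ ε j = true := by
  rw [atomOf, Model.sat_bigConj, List.forall_mem_ofFn_iff]
  refine forall_congr' fun j => ?_
  by_cases h : ε j = true <;> simp [h, Model.Sat]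

/-- All signed formulas of the branch have at `w` the truth values given by their signs. -/
def Model.SatBranch {Γ : List PropSchema} {U : Type u} (M : Model Γ U) (b : Branch) (w : U) :
    Prop :=
  ∀ X ∈ b, (M.Sat X.2 w ↔ X.1 = true)

/-- The branch is satisfiable in a measurable model. -/
def Branch.Satisfiable (Γ : List PropSchema) (b : Branch) : Prop :=
  ∃ (U : Type u) (M : Model Γ U), M.Measurable ∧ ∃ w : U, M.SatBranch b w

theorem Model.satBranch_rootBranch {Γ : List PropSchema} {U : Type u} (M : Model Γ U)
    (A : Formula) (w : U) : M.SatBranch (rootBranch A) w ↔ M.Sat A w := by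
  simp [Model.SatBranch, rootBranch]

theorem satisfiable_rootBranch_iff (Γ : List PropSchema) (A : Formula) :
    Branch.Satisfiable.{u} Γ (rootBranch A) ↔ MeasSatisfiable.{u} Γ A := by
  simp only [Branch.Satisfiable, MeasSatisfiable, Model.satBranch_rootBranch]

theorem Model.SatBranch.not_closed {Γ : List PropSchema} {U : Type u} {M : Model Γ U}
    {b : Branch} {w : U} (h : M.SatBranch b w) : ¬ b.Closed := by
  rintro ⟨A, h₁, h₂⟩
  simpa [(h _ h₁).2 rfl] using h _ h₂

theorem Model.SatBranch.justCheck {Γ : List PropSchema} {U : Type u} {M : Model Γ U}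
    {b : Branch} {w : U} (h : M.SatBranch b w) : b.JustCheck Γ :=
  (M.mmodel w).justCheck (fun _ _ hA => (h _ hA).2 rfl)
    fun _ _ hA hA' => Bool.false_ne_true ((h _ hA).1 hA')

/-- Truth lemma: saturation reduces every formula to atoms, justifications and probabilistic
formulas. The last are left as a hypothesis because their truth depends on the space at `w`, which
differs between complete branches and the probabilistic rule. -/
theorem Model.satBranch_of_saturated {Γ : List PropSchema} {U : Type u} {M : Model Γ U} {w : U}
    {b : Branch} (hc : ¬ b.Closed) (hp : ∀ r, ¬ PropApplicable b r)
    (hatom : ∀ p, (M.mmodel w).val p = true ↔ (true, .atom p) ∈ b)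
    (hT : ∀ t A, (true, .just t A) ∈ b → A ∈ (M.mmodel w).evid t)
    (hF : ∀ t A, (false, .just t A) ∈ b → A ∉ (M.mmodel w).evid t)
    (hprob : ∀ sgn s A, (sgn, .prob s A) ∈ b → (M.Sat (.prob s A) w ↔ sgn = true)) :
    M.SatBranch b w := by
  have key : ∀ (A : Formula) (sgn : Bool), (sgn, A) ∈ b → (M.Sat A w ↔ sgn = true) := by
    intro A
    induction A with
    | atom p =>
      rintro (_ | _) h
      · exact iff_of_false (fun h' => hc ⟨_, (hatom p).1 h', h⟩) Bool.false_ne_true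
      · exact iff_of_true ((hatom p).2 h) rfl
    | neg A ih =>
      rintro (_ | _) h
      · have h' : (true, A) ∈ b := by_contra fun h' => hp _ (.negF A h h')
        exact iff_of_false (not_not.2 ((ih _ h').2 rfl)) Bool.false_ne_true
      · have h' : (false, A) ∈ b := by_contra fun h' => hp _ (.negT A h h')
        exact iff_of_true (fun hA => Bool.false_ne_true ((ih _ h').1 hA)) rfl
    | conj A B hA hB =>
      rintro (_ | _) h
      · refine iff_of_false (fun hAB => hp _ (.conjF A B h ?_ ?_)) Bool.false_ne_true
        · exact fun h' => Bool.false_ne_true ((hA _ h').1 hAB.1)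
        · exact fun h' => Bool.false_ne_true ((hB _ h').1 hAB.2)
      · have h' : (true, A) ∈ b ∧ (true, B) ∈ b := by_contra fun h' => hp _ (.conjT A B h h')
        exact iff_of_true ⟨(hA _ h'.1).2 rfl, (hB _ h'.2).2 rfl⟩ rfl
    | just t A _ =>
      rintro (_ | _) h
      · exact iff_of_false (hF t A h) Bool.false_ne_true
      · exact iff_of_true (hT t A h) rfl
    | prob s A _ => exact fun sgn => hprob sgn s A
  exact fun X hX => key X.2 X.1 hX

/-! ## Correctness of the marking procedure -/

theorem satBranch_result_ext_iff {Γ : List PropSchema} {U : Type u} (M : Model Γ U) (w : U)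
    {b : Branch} {S : List Signed} (h : PropApplicable b (.ext S)) :
    M.SatBranch ((RuleApp.ext S).result b ()) w ↔ M.SatBranch b w := by
  have hS : M.SatBranch b w → M.SatBranch S w := by
    intro hb
    cases h with
    | negT A h _ | negF A h _ =>
      have := hb _ h
      simpa [Model.SatBranch, Model.Sat] using this
    | conjT A B h _ =>
      have := hb _ h
      simpa [Model.SatBranch, Model.Sat] using this
  rw [RuleApp.result, Model.SatBranch, List.forall_mem_append]
  exact ⟨And.right, fun hb => ⟨hS hb, hb⟩⟩

theorem satBranch_result_split_iff {Γ : List PropSchema} {U : Type u} (M : Model Γ U) (w : U)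
    {b : Branch} {X Y : Signed} (h : PropApplicable b (.split X Y)) :
    (∃ i : Bool, M.SatBranch ((RuleApp.split X Y).result b i) w) ↔ M.SatBranch b w := by
  cases h with
  | conjF A B h _ _ =>
    simp only [Bool.exists_bool, RuleApp.result, Model.SatBranch, List.forall_mem_cons]
    refine ⟨fun h => h.elim And.right And.right, fun hb => ?_⟩
    have := hb _ h
    simp only [Model.Sat, Bool.false_eq_true, iff_false, not_and_or] at this
    -- `Bool.exists_bool` lists `false` first, and `false` indexes the second alternative `F B`.
    rcases this with h | h
    · exact Or.inr ⟨iff_of_false h Bool.false_ne_true, hb⟩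
    · exact Or.inl ⟨iff_of_false h Bool.false_ne_true, hb⟩

/-- On a complete open branch no probabilistic formula occurs. -/
theorem Branch.Complete.prob_notMem {b : Branch} (hb : b.Complete) (hc : ¬ b.Closed)
    (sgn : Bool) (s : Rat01) (A : Formula) : (sgn, .prob s A) ∉ b := by
  classical
  intro h
  let P : Set Formula := {C | ∃ (sgn : Bool) (s : Rat01), (sgn, .prob s C) ∈ b}
  have hP : P.Finite := by
    -- The map strips the outer probability operator; its value on other formulas is arbitrary, as
    -- only an inclusion is needed.
    refine (b.toFinset.finite_toSet.image
      fun X => match X.2 with | .prob _ C => C | C => C).subset ?_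
    rintro C ⟨sgn, s, h⟩
    exact ⟨_, List.mem_toFinset.2 h, rfl⟩
  have := hP.to_subtype
  obtain ⟨m, ⟨e⟩⟩ := Finite.exists_equiv_fin P
  refine hb _ (.probabilistic m (fun j => (e.symm j).1)
    ⟨hc, fun r hr => hb r (.propositional r hr), ?_, ?_, fun C => ⟨?_, fun hC => ?_⟩⟩)
  · exact Fin.pos (e ⟨A, sgn, s, h⟩)
  · exact Subtype.val_injective.comp e.symm.injective
  · rintro ⟨j, rfl⟩
    exact (e.symm j).2
  · exact ⟨e ⟨C, hC⟩, by simp⟩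

/-- One world with a point mass suffices: the least evidence function settles the justifications,
and no probabilistic formula is left. -/
theorem satisfiable_of_complete {Γ : List PropSchema} {b : Branch} (hc : ¬ b.Closed)
    (hj : b.JustCheck Γ) (hb : b.Complete) : Branch.Satisfiable.{u} Γ b := by
  classical
  let N : MModel Γ := b.mmodel Γ fun p => decide ((true, .atom p) ∈ b)
  -- Over the empty family the only world is `none`; `PUnit` serves to fix the universe.
  let S : ProbSpace (Option (Σ i : Empty, (fun _ : Empty => PUnit.{u + 1}) i)) :=
    (ProbSpace.ofWeights (fun _ : Unit => 1) (by simp) (by simp)).map fun _ => none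
  refine ⟨_, Model.graft (fun i : Empty => i.elim) S N, .graft (fun i => i.elim) ?_ N, none, ?_⟩
  · exact fun X hX => ⟨hX, trivial⟩
  · exact Model.satBranch_of_saturated hc (fun r hr => hb r (.propositional r hr))
      (fun p => decide_eq_true_iff) (fun _ _ h => Branch.mem_evid_mmodel h)
      (fun _ _ h => hj.notMem_evid h) fun sgn s A h => absurd h (hb.prob_notMem hc sgn s A)

/-- Models of the satisfiable sign choices are grafted under a new world, whose measure is the
push-forward of the solution `x`. The measure of `B j` there is then the sum in the linear system.
-/
theorem satisfiable_of_probSystemSolvable {Γ : List PropSchema} {b : Branch} {m : ℕ}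
    {B : Fin m → Formula} (h : ProbApplicable b m B) (hj : b.JustCheck Γ)
    (hs : ProbSystemSolvable b B fun ε =>
      Branch.Satisfiable.{u} Γ ((RuleApp.prob m B).result b ε)) :
    Branch.Satisfiable.{u} Γ b := by
  classical
  obtain ⟨hc, hp, -, -, hB⟩ := h
  obtain ⟨x, h₁, h₀, hx, hT, hF⟩ := hs
  let ι := {ε : Fin m → Bool // Branch.Satisfiable.{u} Γ ((RuleApp.prob m B).result b ε)}
  choose U M hM v hv using fun i : ι => i.2
  -- Unsatisfiable sign choices are sent to the new world itself; their weight is zero, so what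
  -- holds there does not affect the measures.
  let f : (Fin m → Bool) → Option (Σ i : ι, U i) :=
    fun ε => if h : Branch.Satisfiable.{u} Γ ((RuleApp.prob m B).result b ε) then
      some ⟨⟨ε, h⟩, v ⟨ε, h⟩⟩ else none
  let N : MModel Γ := b.mmodel Γ fun p => decide ((true, .atom p) ∈ b)
  let S : ProbSpace (Option (Σ i : ι, U i)) := (ProbSpace.ofWeights x h₀ h₁).map f
  have hS : ∀ X ⊆ S.W, X ∈ S.H := fun X hX => ⟨hX, trivial⟩
  let M' := Model.graft M S N
  have hμ : ∀ j (h : M'.truthSet (B j) none ∈ S.H),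
      (S.μ ⟨_, h⟩ : ℝ) = ∑ ε with ε j = true, x ε := by
    intro j h
    rw [ProbSpace.μ_map_ofWeights, Finset.sum_filter, Finset.sum_filter]
    refine Finset.sum_congr rfl fun ε _ => ?_
    by_cases hε : Branch.Satisfiable.{u} Γ ((RuleApp.prob m B).result b ε)
    · have hf : f ε = some ⟨⟨ε, hε⟩, v ⟨ε, hε⟩⟩ := dif_pos hε
      have hsat : M'.Sat (B j) (f ε) ↔ ε j = true := by
        rw [hf, Model.sat_graft]
        exact ((M ⟨ε, hε⟩).sat_atomOf _ B ε).1
          ((hv ⟨ε, hε⟩ _ (List.mem_singleton.2 rfl)).2 rfl) j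
      refine if_congr ?_ rfl rfl
      rw [← hsat]
      exact ⟨fun h => h.2, fun h => ⟨Set.mem_image_of_mem f trivial, h⟩⟩
    · rw [hx ε hε, ite_self, ite_self]
  refine ⟨_, M', .graft hM hS N, none, ?_⟩
  refine Model.satBranch_of_saturated hc hp (fun p => decide_eq_true_iff)
    (fun _ _ h => Branch.mem_evid_mmodel h) (fun _ _ h => hj.notMem_evid h) fun sgn s A h => ?_
  obtain ⟨j, rfl⟩ := (hB A).2 ⟨sgn, s, h⟩
  have hmem : M'.truthSet (B j) none ∈ S.H := hS _ fun v hv => hv.1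
  cases sgn with
  | true => exact iff_of_true ⟨hmem, (hT s j h).trans_eq (hμ j hmem).symm⟩ rfl
  | false =>
    refine iff_of_false (fun ⟨h', hle⟩ => ?_) Bool.false_ne_true
    exact absurd (hle.trans_eq (hμ j h')) (not_le.2 (hF s j h))

/-- The solution is the measure of each signed conjunction. These are disjoint and cover the space,
and `B j` is the union of those with positive sign at `j`; finite additivity gives the sums. -/
theorem probSystemSolvable_of_satBranch {Γ : List PropSchema} {U : Type u} {M : Model Γ U}
    (hM : M.Measurable) {b : Branch} {w : U} (hb : M.SatBranch b w) {m : ℕ}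
    (B : Fin m → Formula) :
    ProbSystemSolvable b B fun ε =>
      Branch.Satisfiable.{u} Γ ((RuleApp.prob m B).result b ε) := by
  classical
  have hX : ∀ ε, M.truthSet (atomOf B ε) w ∈ (M.space w).H := fun ε => hM w _
  have hd : Pairwise fun ε ε' => Disjoint (M.truthSet (atomOf B ε) w)
      (M.truthSet (atomOf B ε') w) := by
    refine fun ε ε' hne => Set.disjoint_left.2 fun v hv hv' => hne (funext fun j => ?_)
    rw [Bool.eq_iff_iff, ← (M.sat_atomOf v B ε).1 hv.2 j, (M.sat_atomOf v B ε').1 hv'.2 j]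
  have hsum : ∀ (s : Finset (Fin m → Bool)) (Y : Set U) (hY : Y ∈ (M.space w).H),
      (⋃ ε ∈ s, M.truthSet (atomOf B ε) w) = Y →
      ∑ ε ∈ s, ((M.space w).μ ⟨_, hX ε⟩ : ℝ) = ((M.space w).μ ⟨Y, hY⟩ : ℝ) := by
    rintro s _ hY rfl
    exact ((M.space w).exists_μ_biUnion hX hd s).2.symm
  have hatom : ∀ v, M.Sat (atomOf B fun j => decide (M.Sat (B j) v)) v :=
    fun v => (M.sat_atomOf v B _).2 fun j => decide_eq_true_iff.symm
  have hj : ∀ j, ∑ ε with ε j = true, ((M.space w).μ ⟨_, hX ε⟩ : ℝ) =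
      ((M.space w).μ ⟨_, hM w (B j)⟩ : ℝ) := by
    refine fun j => hsum _ _ _ (Set.ext fun v => ?_)
    simp only [Set.mem_iUnion, Finset.mem_filter, Finset.mem_univ, true_and, exists_prop]
    constructor
    · rintro ⟨ε, hε, hv⟩
      exact ⟨hv.1, ((M.sat_atomOf v B ε).1 hv.2 j).2 hε⟩
    · exact fun hv => ⟨_, decide_eq_true hv.2, hv.1, hatom v⟩
  refine ⟨fun ε => (M.space w).μ ⟨_, hX ε⟩, ?_, fun ε => ((M.space w).μ _).2.1, ?_, ?_, ?_⟩
  · rw [hsum _ _ (M.space w).whole_mem, (M.space w).μ_whole]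
    refine Set.ext fun v => ?_
    simp only [Set.mem_iUnion, Finset.mem_univ, exists_prop, true_and]
    exact ⟨fun ⟨_, hv⟩ => hv.1, fun hv => ⟨_, hv, hatom v⟩⟩
  · intro ε hε
    dsimp only
    -- A conjunction that is unsatisfiable in all measurable models holds nowhere in `M`; its truth
    -- set is the empty union, of measure `0`.
    rw [← hsum ∅ _ (hX ε), Finset.sum_empty]
    simp only [Finset.notMem_empty, Set.iUnion_false, Set.iUnion_empty]
    refine (Set.eq_empty_of_forall_notMem fun v hv => hε ⟨U, M, hM, v, fun X hX => ?_⟩).symm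
    cases List.mem_singleton.1 hX
    exact iff_of_true hv.2 rfl
  · intro s j h
    obtain ⟨_, hs⟩ := (hb _ h).2 rfl
    exact hs.trans_eq (hj j).symm
  · intro s j h
    rw [hj]
    exact not_le.1 fun hle => Bool.false_ne_true ((hb _ h).1 ⟨hM w (B j), hle⟩)

/-- At a leaf, a satisfiable branch is open and hence complete, and it passes the check. At a
probabilistic node the induction hypothesis turns the marks of the new worlds into satisfiability,
and the two lemmas on the linear system apply. -/
theorem IsTableau.marked_iff {Γ : List PropSchema} {b : Branch} {T : Tableau}
    (h : IsTableau b T) : T.Marked Γ b ↔ Branch.Satisfiable.{u} Γ b := by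
  induction h with
  | leaf b h =>
    refine ⟨fun ⟨hc, hj, hb⟩ => satisfiable_of_complete hc hj hb, ?_⟩
    rintro ⟨U, M, -, w, hw⟩
    exact ⟨hw.not_closed, hw.justCheck, h.resolve_left hw.not_closed⟩
  | node b r child hr _ ih =>
    cases hr with
    | propositional _ hr =>
      cases r with
      | ext S =>
        rw [Tableau.Marked, ih]
        simp only [Branch.Satisfiable, satBranch_result_ext_iff _ _ hr]
      | split X Y =>
        simp only [Tableau.Marked, ih, Branch.Satisfiable, ← satBranch_result_split_iff _ _ hr]
        grind
      | prob m B => cases hr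
    | probabilistic m B hr =>
      simp only [Tableau.Marked, ih]
      constructor
      · exact fun h => satisfiable_of_probSystemSolvable hr h.2.1 h.2.2
      · rintro ⟨U, M, hM, w, hw⟩
        exact ⟨hw.not_closed, hw.justCheck, probSystemSolvable_of_satBranch hM hw B⟩

end PPJ

theorem mainTheorem3 (Γ : List PPJ.PropSchema) (A : PPJ.Formula) :
    Acc PPJ.Expands (PPJ.rootBranch A) ∧
    (∃ T : PPJ.Tableau, PPJ.IsTableau (PPJ.rootBranch A) T) ∧
    ∀ T : PPJ.Tableau, PPJ.IsTableau (PPJ.rootBranch A) T →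
      (PPJ.ReturnsSatisfiable Γ A T ↔ PPJ.MeasSatisfiable.{u} Γ A) :=
  ⟨PPJ.acc_expands_rootBranch A, PPJ.exists_isTableau (PPJ.acc_expands_rootBranch A),
    fun _ hT => hT.marked_iff.trans (PPJ.satisfiable_rootBranch_iff Γ A)⟩
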